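/- Let $q\in\mathbb C^{*}$, $q^2\neq 1$, and let $a_{ii}=2$, $a_{ij}=-1$ $(i\ne j)$, $i,j=1,2,3$, be the Cartan matrix of type $A_2^{(1)}$. Let $\mathcal A=U_q(\widehat{sl}_3)$ be the $\mathbb C$-algebra generated by $x_i,y_i,q^{\pm h_i}$ $(i=1,2,3)$ and $q^{\pm d}$, where the $q^{h_i},q^{d}$ are invertible and commute, with the relations $q^{h_i}x_j=q^{-a_{ij}}x_jq^{h_i}$, $q^{h_i}y_j=q^{a_{ij}}y_jq^{h_i}$, $q^{d}x_i=q^{-\delta_{i3}}x_iq^{d}$, $q^dy_i=q^{\delta_{i3}}y_iq^d$, $[y_i,x_j]=\delta_{ij}\frac{q^{h_i}-q^{-h_i}}{q-q^{-1}}$, and, for $i\neq j$, the Serre relations $$x_i^2x_j-(q+q^{-1})x_ix_jx_i+x_jx_i^2=0,\qquad y_i^2y_j-(q+q^{-1})y_iy_jy_i+y_jy_i^2=0 .$$ Its comultiplication is $\delta(x_i)=x_i\otimes1+q^{-h_i}\otimes x_i$, $\delta(y_i)=y_i\otimes q^{h_i}+1\otimes y_i$, with $q^{h_i},q^d$ group-like;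 $\delta'=\sigma\circ\delta$ with $\sigma(a\otimes b)=b\otimes a$. Let $\mathcal R=q^{\mathsf t}\,\overline{\mathcal R}$ be the universal $R$-matrix, that is, $\delta'(a)\mathcal R=\mathcal R\,\delta(a)$ for all $a\in\mathcal A$, $(\delta\otimes1)\mathcal R=\mathcal R^{13}\mathcal R^{23}$ and $(1\otimes\delta)\mathcal R=\mathcal R^{13}\mathcal R^{12}$. Here $\mathsf t$ is the invariant tensor of the Cartan subalgebra, so that $q^{\mathsf t}$ commutes with the Cartan part and $$q^{\mathsf t}(y_i\otimes1)=(y_i\otimes q^{h_i})q^{\mathsf t},\quad q^{\mathsf t}(x_i\otimes1)=(x_i\otimes q^{-h_i})q^{\mathsf t},\quad q^{\mathsf t}(1\otimes y_i)=(q^{h_i}\otimes y_i)q^{\mathsf t},\quad q^{\mathsf t}(1\otimes x_i)=(q^{-h_i}\otimes x_i)q^{\mathsf t},$$ and the reduced universal $R$-matrix $\overline{\mathcal R}=1+\dots$ is a formal power series in the $y_i\otimes1$ and $1\otimes x_i$, with components of equal degree in the $y_i\otimes 1$ and in the $1\otimes x_i$. Let $C$ be an associative unital $\mathbb C$-algebra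 with elements $x_1,x_2,x_3\in C$ satisfying the Serre relations, and let $I,A_i,B_i\in C$ $(i=1,2,3)$ satisfy $$[I,x_i]=\frac{A_i-B_i}{q-q^{-1}},\qquad A_ix_j=q^{a_{ij}}x_jA_i,\qquad B_ix_j=q^{-a_{ij}}x_jB_i\qquad(i,j=1,2,3).$$ Let $U_q(\mathfrak n_+)$ be the algebra generated by $y_1,y_2,y_3$ with the Serre relations, and evaluate the second tensor factor of $\overline{\mathcal R}$ at the given $x_i\in C$. Then, in the completion of $U_q(\mathfrak n_+)\otimes C$ with respect to the degree in the $y_i$, $$[1\otimes I,\overline{\mathcal R}]=\Big(\sum_{i=1}^3y_i\otimes A_i\Big)\overline{\mathcal R}-\overline{\mathcal R}\Big(\sum_{i=1}^3y_i\otimes B_i\Big).$$ -/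

import Mathlib

open scoped TensorProduct

noncomputable section

namespace AffineSl3

/-- The Cartan matrix `a i j` of type `A_2^{(1)}`; the indices `1, 2, 3` are `0, 1, 2 : Fin 3`. -/
def cartan (i j : Fin 3) : ℤ := if i = j then 2 else -1

/-- The `q`-number `[2]_q = (q ^ 2 - q ^ (-2)) / (q - q ^ (-1)) = q + q ^ (-1)`. -/
def qTwo (q : ℂˣ) : ℂ := (q : ℂ) + (q : ℂ)⁻¹

theorem qTwo_eq (q : ℂˣ) (hq : (q : ℂ) ^ 2 ≠ 1) :
    ((q : ℂ) ^ (2 : ℤ) - (q : ℂ) ^ (-2 : ℤ)) / ((q : ℂ) - (q : ℂ)⁻¹) = qTwo q := by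
  have h0 : (q : ℂ) ≠ 0 := q.ne_zero
  have h1 : (q : ℂ) - (q : ℂ)⁻¹ ≠ 0 := by
    intro h
    apply hq
    field_simp at h
    linear_combination h
  rw [div_eq_iff h1, qTwo, zpow_neg]
  norm_cast
  push_cast
  field_simp
  ring

/-- The cubic Serre relations for a triple of elements of a ring. -/
def Serre (q : ℂˣ) {S : Type*} [Ring S] [Algebra ℂ S] (x : Fin 3 → S) : Prop :=
  ∀ i j : Fin 3, i ≠ j →
    x i ^ 2 * x j - qTwo q • (x i * x j * x i) + x j * x i ^ 2 = 0

/-! ### The algebra with three generators and the Serre relations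

It is both `U_q(n_+)` (generators `y i`) and `U_q(n_-)` (generators `x i`). -/

inductive NilRel (q : ℂˣ) : FreeAlgebra ℂ (Fin 3) → FreeAlgebra ℂ (Fin 3) → Prop
  | serre (i j : Fin 3) (hij : i ≠ j) : NilRel q
      (FreeAlgebra.ι ℂ i ^ 2 * FreeAlgebra.ι ℂ j
        - qTwo q • (FreeAlgebra.ι ℂ i * FreeAlgebra.ι ℂ j * FreeAlgebra.ι ℂ i)
        + FreeAlgebra.ι ℂ j * FreeAlgebra.ι ℂ i ^ 2) 0

/-- The algebra generated by three elements `gen q i` subject to the Serre relations. -/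
def Nil (q : ℂˣ) : Type := RingQuot (NilRel q)

instance (q : ℂˣ) : Ring (Nil q) := inferInstanceAs (Ring (RingQuot (NilRel q)))

instance (q : ℂˣ) : Algebra ℂ (Nil q) := inferInstanceAs (Algebra ℂ (RingQuot (NilRel q)))

namespace Nil

def gen (q : ℂˣ) (i : Fin 3) : Nil q :=
  RingQuot.mkAlgHom ℂ (NilRel q) (FreeAlgebra.ι ℂ i)

/-- The algebra map that sends the generators to a triple satisfying the Serre relations. -/
def lift {q : ℂˣ} {S : Type*} [Ring S] [Algebra ℂ S] (x : Fin 3 → S) (hx : Serre q x) :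
    Nil q →ₐ[ℂ] S :=
  RingQuot.liftAlgHom ℂ ⟨FreeAlgebra.lift ℂ x, by
    rintro _ _ ⟨i, j, hij⟩
    simpa using hx i j hij⟩

theorem lift_gen {q : ℂˣ} {S : Type*} [Ring S] [Algebra ℂ S] (x : Fin 3 → S)
    (hx : Serre q x) (i : Fin 3) : lift x hx (gen q i) = x i := by
  unfold lift gen
  exact (RingQuot.liftAlgHom_mkAlgHom_apply ..).trans (FreeAlgebra.lift_ι_apply ..)

/-- The span of the elements `u ⊗ v` with `u` and `v` words of length `n` in the generators. -/
def bidegree (q : ℂˣ) (n : ℕ) : Submodule ℂ (Nil q ⊗[ℂ] Nil q) :=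
  Submodule.span ℂ {z | ∃ u v : List (Fin 3), u.length = n ∧ v.length = n ∧
    z = (u.map (gen q)).prod ⊗ₜ[ℂ] (v.map (gen q)).prod}

end Nil

/-! ### The quantum affine algebra -/

/-- Generators of `U_q(sl_3^)`: `x i`, `y i`, `K i = q ^ (h i)`, `K' i = q ^ (- h i)`,
`D = q ^ d`, `D' = q ^ (- d)`. -/
inductive Gen : Type
  | x (i : Fin 3) | y (i : Fin 3) | K (i : Fin 3) | K' (i : Fin 3) | D | D'

/-- The list of defining relations of `U_q(sl_3^)`, written for a family `g` of elements of an
algebra: `UqEq q g a b` says that `a = b` is one of the relations. -/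
inductive UqEq (q : ℂˣ) {S : Type*} [Ring S] [Algebra ℂ S] (g : Gen → S) : S → S → Prop
  | K_mul_K' (i) : UqEq q g (g (.K i) * g (.K' i)) 1
  | K'_mul_K (i) : UqEq q g (g (.K' i) * g (.K i)) 1
  | D_mul_D' : UqEq q g (g .D * g .D') 1
  | D'_mul_D : UqEq q g (g .D' * g .D) 1
  | K_comm (i j) : UqEq q g (g (.K i) * g (.K j)) (g (.K j) * g (.K i))
  | D_comm (i) : UqEq q g (g .D * g (.K i)) (g (.K i) * g .D)
  | K_x (i j) : UqEq q g (g (.K i) * g (.x j)) (((q : ℂ) ^ (-cartan i j)) • (g (.x j) * g (.K i)))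
  | K_y (i j) : UqEq q g (g (.K i) * g (.y j)) (((q : ℂ) ^ cartan i j) • (g (.y j) * g (.K i)))
  | D_x (i) : UqEq q g (g .D * g (.x i)) ((if i = 2 then (q : ℂ)⁻¹ else 1) • (g (.x i) * g .D))
  | D_y (i) : UqEq q g (g .D * g (.y i)) ((if i = 2 then (q : ℂ) else 1) • (g (.y i) * g .D))
  | y_x (i j) : UqEq q g (g (.y i) * g (.x j) - g (.x j) * g (.y i))
      (if i = j then ((q : ℂ) - (q : ℂ)⁻¹)⁻¹ • (g (.K i) - g (.K' i)) else 0)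
  | serre_x (i j) (hij : i ≠ j) : UqEq q g
      (g (.x i) ^ 2 * g (.x j) - qTwo q • (g (.x i) * g (.x j) * g (.x i))
        + g (.x j) * g (.x i) ^ 2) 0
  | serre_y (i j) (hij : i ≠ j) : UqEq q g
      (g (.y i) ^ 2 * g (.y j) - qTwo q • (g (.y i) * g (.y j) * g (.y i))
        + g (.y j) * g (.y i) ^ 2) 0

/-- The family `g` satisfies all the defining relations. -/
def UqRelations (q : ℂˣ) {S : Type*} [Ring S] [Algebra ℂ S] (g : Gen → S) : Prop :=
  ∀ a b, UqEq q g a b → a = b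

/-- The quantum affine algebra `A = U_q(sl_3^)`, including the grading element. -/
def Uq (q : ℂˣ) : Type := RingQuot (UqEq q (FreeAlgebra.ι ℂ : Gen → FreeAlgebra ℂ Gen))

instance (q : ℂˣ) : Ring (Uq q) := inferInstanceAs (Ring (RingQuot _))

instance (q : ℂˣ) : Algebra ℂ (Uq q) := inferInstanceAs (Algebra ℂ (RingQuot _))

namespace Uq

variable {q : ℂˣ} {S : Type*} [Ring S] [Algebra ℂ S]

def gen (q : ℂˣ) (a : Gen) : Uq q := RingQuot.mkAlgHom ℂ _ (FreeAlgebra.ι ℂ a)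

theorem map_rel {T : Type*} [Ring T] [Algebra ℂ T] (f : S →ₐ[ℂ] T) {g : Gen → S} {a b : S}
    (h : UqEq q g a b) : UqEq q (fun z => f (g z)) (f a) (f b) := by
  cases h with
  | K_mul_K' i => simpa using UqEq.K_mul_K' (q := q) (g := fun z => f (g z)) i
  | K'_mul_K i => simpa using UqEq.K'_mul_K (q := q) (g := fun z => f (g z)) i
  | D_mul_D' => simpa using UqEq.D_mul_D' (q := q) (g := fun z => f (g z))
  | D'_mul_D => simpa using UqEq.D'_mul_D (q := q) (g := fun z => f (g z))
  | K_comm i j => simpa using UqEq.K_comm (q := q) (g := fun z => f (g z)) i j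
  | D_comm i => simpa using UqEq.D_comm (q := q) (g := fun z => f (g z)) i
  | K_x i j => simpa only [map_mul, map_smul] using UqEq.K_x (q := q) (g := fun z => f (g z)) i j
  | K_y i j => simpa only [map_mul, map_smul] using UqEq.K_y (q := q) (g := fun z => f (g z)) i j
  | D_x i => simpa only [map_mul, map_smul] using UqEq.D_x (q := q) (g := fun z => f (g z)) i
  | D_y i => simpa only [map_mul, map_smul] using UqEq.D_y (q := q) (g := fun z => f (g z)) i
  | y_x i j =>
    simpa only [map_mul, map_smul, map_sub, apply_ite f, map_zero] using
      UqEq.y_x (q := q) (g := fun z => f (g z)) i j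
  | serre_x i j hij =>
    simpa only [map_mul, map_smul, map_sub, map_add, map_pow, map_zero] using
      UqEq.serre_x (q := q) (g := fun z => f (g z)) i j hij
  | serre_y i j hij =>
    simpa only [map_mul, map_smul, map_sub, map_add, map_pow, map_zero] using
      UqEq.serre_y (q := q) (g := fun z => f (g z)) i j hij

/-- The algebra map determined by a family that satisfies the defining relations. -/
def lift (g : Gen → S) (hg : UqRelations q g) : Uq q →ₐ[ℂ] S :=
  RingQuot.liftAlgHom ℂ ⟨FreeAlgebra.lift ℂ g, fun _ _ h => hg _ _ (by
    simpa only [FreeAlgebra.lift_ι_apply] using map_rel (FreeAlgebra.lift ℂ g) h)⟩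

theorem lift_gen (g : Gen → S) (hg : UqRelations q g) (a : Gen) : lift g hg (gen q a) = g a := by
  unfold lift gen
  exact (RingQuot.liftAlgHom_mkAlgHom_apply ..).trans (FreeAlgebra.lift_ι_apply ..)

theorem relations_of_map {T : Type*} [Ring T] [Algebra ℂ T] (f : S →ₐ[ℂ] T) {g : Gen → S}
    (hr : ∀ a b, UqEq q g a b → f a = f b) : UqRelations q (fun z => f (g z)) := by
  intro a b h
  have aux : ∀ {a' b'}, UqEq q g a' b' → a = f a' → b = f b' → a = b :=
    fun h' ha hb => ha.trans ((hr _ _ h').trans hb.symm)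
  cases h with
  | K_mul_K' i => exact aux (.K_mul_K' i) (by simp) (by simp)
  | K'_mul_K i => exact aux (.K'_mul_K i) (by simp) (by simp)
  | D_mul_D' => exact aux .D_mul_D' (by simp) (by simp)
  | D'_mul_D => exact aux .D'_mul_D (by simp) (by simp)
  | K_comm i j => exact aux (.K_comm i j) (by simp) (by simp)
  | D_comm i => exact aux (.D_comm i) (by simp) (by simp)
  | K_x i j => exact aux (.K_x i j) (by simp) (by simp only [map_mul, map_smul])
  | K_y i j => exact aux (.K_y i j) (by simp) (by simp only [map_mul, map_smul])
  | D_x i => exact aux (.D_x i) (by simp) (by simp only [map_mul, map_smul])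
  | D_y i => exact aux (.D_y i) (by simp) (by simp only [map_mul, map_smul])
  | y_x i j =>
    exact aux (.y_x i j) (by simp) (by simp only [map_smul, map_sub, apply_ite f, map_zero])
  | serre_x i j hij =>
    exact aux (.serre_x i j hij)
      (by simp only [map_mul, map_smul, map_sub, map_add, map_pow]) (by simp)
  | serre_y i j hij =>
    exact aux (.serre_y i j hij)
      (by simp only [map_mul, map_smul, map_sub, map_add, map_pow]) (by simp)

theorem gen_relations (q : ℂˣ) : UqRelations q (gen q) :=
  relations_of_map (RingQuot.mkAlgHom ℂ _) (fun _ _ h => RingQuot.mkAlgHom_rel ℂ h)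

theorem relations_map {T : Type*} [Ring T] [Algebra ℂ T] (f : Uq q →ₐ[ℂ] T) :
    UqRelations q (fun z => f (gen q z)) :=
  relations_of_map f (fun _ _ h => congrArg f (gen_relations q _ _ h))

theorem algHom_ext {f f' : Uq q →ₐ[ℂ] S} (h : ∀ z, f (gen q z) = f' (gen q z)) : f = f' :=
  RingQuot.ringQuot_ext' ℂ _ _ (FreeAlgebra.hom_ext (funext h))

/-- Two algebra maps out of `U_q(sl_3^)` have commuting ranges if they do on generators. -/
theorem commute_of_gen (f f' : Uq q →ₐ[ℂ] S)
    (h : ∀ z w, Commute (f (gen q z)) (f' (gen q w))) (a b : Uq q) : Commute (f a) (f' b) := by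
  have ind : ∀ (F : Uq q →ₐ[ℂ] S) (c : S), (∀ z, Commute (F (gen q z)) c) →
      ∀ a, Commute (F a) c := by
    intro F c hc a
    obtain ⟨a, rfl⟩ := RingQuot.mkAlgHom_surjective ℂ _ a
    induction a using FreeAlgebra.induction with
    | grade0 r =>
      rw [AlgHom.commutes]
      exact (congrArg (Commute · c) (F.commutes r)).mpr (Algebra.commutes r c)
    | grade1 z => exact hc z
    | mul a b ha hb =>
      rw [map_mul]
      exact (congrArg (Commute · c) (map_mul F _ _)).mpr (ha.mul_left hb)
    | add a b ha hb =>
      rw [map_add]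
      exact (congrArg (Commute · c) (map_add F _ _)).mpr (ha.add_left hb)
  exact ind f _ (fun z => (ind f' _ (fun w => (h z w).symm) b).symm) a

/-- The family obtained by multiplying `x i` by `u i` and `y i` by `v i`. -/
def twist (g : Gen → S) (u v : Fin 3 → S) : Gen → S
  | .x i => g (.x i) * u i
  | .y i => g (.y i) * v i
  | .K i => g (.K i)
  | .K' i => g (.K' i)
  | .D => g .D
  | .D' => g .D'

theorem serre_twist (r : ℂ) (a b u w : S) (h : a ^ 2 * b - r • (a * b * a) + b * a ^ 2 = 0)
    (hau : Commute a u) (haw : Commute a w) (hbu : Commute b u) (huw : Commute u w) :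
    (a * u) ^ 2 * (b * w) - r • (a * u * (b * w) * (a * u)) + b * w * (a * u) ^ 2 = 0 := by
  have e1 : (a * u) ^ 2 * (b * w) = a ^ 2 * b * (u ^ 2 * w) := by
    rw [hau.mul_pow, mul_assoc, ← mul_assoc (u ^ 2), ← (hbu.pow_right 2).eq]
    simp only [mul_assoc]
  have e2 : a * u * (b * w) * (a * u) = a * b * a * (u ^ 2 * w) := by
    calc a * u * (b * w) * (a * u) = a * (u * b) * (w * a) * u := by simp only [mul_assoc]
      _ = a * (b * u) * (a * w) * u := by rw [hbu.eq, haw.eq]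
      _ = a * b * (u * a) * (w * u) := by simp only [mul_assoc]
      _ = a * b * (a * u) * (u * w) := by rw [hau.eq, huw.eq]
      _ = _ := by simp only [mul_assoc, pow_two]
  have e3 : b * w * (a * u) ^ 2 = b * a ^ 2 * (u ^ 2 * w) := by
    rw [hau.mul_pow, mul_assoc, ← mul_assoc w, ← (haw.pow_left 2).eq, mul_assoc (a ^ 2),
      ← (huw.pow_left 2).eq]
    simp only [mul_assoc]
  rw [e1, e2, e3, ← smul_mul_assoc, ← sub_mul, ← add_mul, h, zero_mul]

theorem relations_twist {g : Gen → S} (hg : UqRelations q g) {u v : Fin 3 → S}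
    (hvu : ∀ i, v i * u i = 1)
    (hu : ∀ i z, Commute (u i) (g z)) (hv : ∀ i z, Commute (v i) (g z))
    (huu : ∀ i j, Commute (u i) (u j)) (hvv : ∀ i j, Commute (v i) (v j))
    (huv' : ∀ i j, Commute (u i) (v j)) : UqRelations q (twist g u v) := by
  intro a b h
  cases h with
  | K_mul_K' i => exact hg _ _ (.K_mul_K' i)
  | K'_mul_K i => exact hg _ _ (.K'_mul_K i)
  | D_mul_D' => exact hg _ _ .D_mul_D'
  | D'_mul_D => exact hg _ _ .D'_mul_D
  | K_comm i j => exact hg _ _ (.K_comm i j)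
  | D_comm i => exact hg _ _ (.D_comm i)
  | K_x i j =>
    simp only [twist]
    rw [← mul_assoc, hg _ _ (.K_x i j), mul_assoc, (hu j (.K i)).eq, smul_mul_assoc, mul_assoc]
  | K_y i j =>
    simp only [twist]
    rw [← mul_assoc, hg _ _ (.K_y i j), mul_assoc, (hv j (.K i)).eq, smul_mul_assoc, mul_assoc]
  | D_x i =>
    simp only [twist]
    rw [← mul_assoc, hg _ _ (.D_x i), mul_assoc, (hu i .D).eq, smul_mul_assoc, mul_assoc]
  | D_y i =>
    simp only [twist]
    rw [← mul_assoc, hg _ _ (.D_y i), mul_assoc, (hv i .D).eq, smul_mul_assoc, mul_assoc]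
  | y_x i j =>
    simp only [twist]
    have e1 : g (.y i) * v i * (g (.x j) * u j) = g (.y i) * g (.x j) * (v i * u j) := by
      rw [mul_assoc, ← mul_assoc (v i), (hv i (.x j)).eq]; simp only [mul_assoc]
    have e2 : g (.x j) * u j * (g (.y i) * v i) = g (.x j) * g (.y i) * (v i * u j) := by
      rw [mul_assoc, ← mul_assoc (u j), (hu j (.y i)).eq, mul_assoc (g (.y i)), (huv' j i).eq]
      simp only [mul_assoc]
    rw [e1, e2, ← sub_mul, hg _ _ (.y_x i j)]
    split_ifs with hij
    · subst hij
      rw [hvu, mul_one]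
    · rw [zero_mul]
  | serre_x i j hij =>
    exact serre_twist _ _ _ _ _ (hg _ _ (.serre_x i j hij)) (hu i _).symm (hu j _).symm
      (hu i _).symm (huu i j)
  | serre_y i j hij =>
    exact serre_twist _ _ _ _ _ (hg _ _ (.serre_y i j hij)) (hv i _).symm (hv j _).symm
      (hv i _).symm (hvv i j)

/-- The values of the comultiplication on generators, for two commuting families. -/
def comulFamily (g g' : Gen → S) : Gen → S
  | .x i => g (.x i) + g (.K' i) * g' (.x i)
  | .y i => g (.y i) * g' (.K i) + g' (.y i)
  | .K i => g (.K i) * g' (.K i)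
  | .K' i => g (.K' i) * g' (.K' i)
  | .D => g .D * g' .D
  | .D' => g .D' * g' .D'

/-- Sums of `q`-commuting families satisfying the Serre relations satisfy them. -/
theorem serre_add {a b c d : S}
    (hab : a ^ 2 * b - qTwo q • (a * b * a) + b * a ^ 2 = 0)
    (hcd : c ^ 2 * d - qTwo q • (c * d * c) + d * c ^ 2 = 0)
    (hca : c * a = ((q : ℂ) ^ (2 : ℤ)) • (a * c)) (hcb : c * b = ((q : ℂ) ^ (-1 : ℤ)) • (b * c))
    (hda : d * a = ((q : ℂ) ^ (-1 : ℤ)) • (a * d)) :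
    (a + c) ^ 2 * (b + d) - qTwo q • ((a + c) * (b + d) * (a + c)) + (b + d) * (a + c) ^ 2 = 0 := by
  have hq : (q : ℂ) ≠ 0 := q.ne_zero
  have hca' : ∀ t, c * (a * t) = ((q : ℂ) ^ (2 : ℤ)) • (a * (c * t)) := fun t => by
    rw [← mul_assoc, hca, smul_mul_assoc, mul_assoc]
  have hcb' : ∀ t, c * (b * t) = ((q : ℂ) ^ (-1 : ℤ)) • (b * (c * t)) := fun t => by
    rw [← mul_assoc, hcb, smul_mul_assoc, mul_assoc]
  have hda' : ∀ t, d * (a * t) = ((q : ℂ) ^ (-1 : ℤ)) • (a * (d * t)) := fun t => by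
    rw [← mul_assoc, hda, smul_mul_assoc, mul_assoc]
  have e : (a + c) ^ 2 * (b + d) - qTwo q • ((a + c) * (b + d) * (a + c)) + (b + d) * (a + c) ^ 2
      = (a ^ 2 * b - qTwo q • (a * b * a) + b * a ^ 2)
        + (c ^ 2 * d - qTwo q • (c * d * c) + d * c ^ 2) := by
    simp only [pow_two, add_mul, mul_add, mul_assoc, hca, hcb, hda, hca', hcb', hda',
      mul_smul_comm, smul_mul_assoc, smul_smul, qTwo, smul_add]
    match_scalars <;> simp only [zpow_neg, zpow_one, zpow_two] <;> field_simp <;> ring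
  rw [e, hab, hcd, add_zero]

theorem K'_comm_of_K {k k' a : S} {r : ℂ} (hr : r ≠ 0) (h1 : k * k' = 1) (h2 : k' * k = 1)
    (h : k * a = r • (a * k)) : k' * a = r⁻¹ • (a * k') := by
  have h3 : k' * (k * a) * k' = r • (k' * (a * k) * k') := by
    rw [h, mul_smul_comm, smul_mul_assoc]
  rw [← mul_assoc k' k, h2, one_mul, mul_assoc k', mul_assoc a, h1, mul_one] at h3
  rw [h3, smul_smul, inv_mul_cancel₀ hr, one_smul]

theorem cartan_comm (i j : Fin 3) : cartan i j = cartan j i := by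
  simp only [cartan, eq_comm]

theorem relations_comul {g g' : Gen → S} (hg : UqRelations q g) (hg' : UqRelations q g')
    (hc : ∀ z w, Commute (g z) (g' w)) : UqRelations q (comulFamily g g') := by
  have hq : (q : ℂ) ≠ 0 := q.ne_zero
  have swap : ∀ (z w : Gen) (t : S), g' w * (g z * t) = g z * (g' w * t) := fun z w t => by
    rw [← mul_assoc, ← (hc z w).eq, mul_assoc]
  have swap0 : ∀ (z w : Gen), g' w * g z = g z * g' w := fun z w => (hc z w).eq.symm
  have four : ∀ a b c d, g a * g' b * (g c * g' d) = g a * g c * (g' b * g' d) := by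
    intro a b c d
    simp only [mul_assoc, swap]
  have K'x : ∀ {f : Gen → S}, UqRelations q f → ∀ i j,
      f (.K' i) * f (.x j) = ((q : ℂ) ^ cartan i j) • (f (.x j) * f (.K' i)) := by
    intro f hf i j
    have := K'_comm_of_K (zpow_ne_zero _ hq) (hf _ _ (.K_mul_K' i)) (hf _ _ (.K'_mul_K i))
      (hf _ _ (.K_x i j))
    rwa [zpow_neg, inv_inv] at this
  have K'y : ∀ {f : Gen → S}, UqRelations q f → ∀ i j,
      f (.K' i) * f (.y j) = ((q : ℂ) ^ (-cartan i j)) • (f (.y j) * f (.K' i)) := by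
    intro f hf i j
    have := K'_comm_of_K (zpow_ne_zero _ hq) (hf _ _ (.K_mul_K' i)) (hf _ _ (.K'_mul_K i))
      (hf _ _ (.K_y i j))
    rwa [← zpow_neg] at this
  have comm' : ∀ {k k' a : S}, k * k' = 1 → k' * k = 1 → k * a = a * k → k' * a = a * k' := by
    intro k k' a h1 h2 h
    simpa using K'_comm_of_K one_ne_zero h1 h2 (by simpa using h)
  have KK' : ∀ i j, g (.K i) * g (.K' j) = g (.K' j) * g (.K i) := fun i j =>
    (comm' (hg _ _ (.K_mul_K' j)) (hg _ _ (.K'_mul_K j)) (hg _ _ (.K_comm j i))).symm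
  have K'K' : ∀ i j, g (.K' i) * g (.K' j) = g (.K' j) * g (.K' i) := fun i j =>
    comm' (hg _ _ (.K_mul_K' i)) (hg _ _ (.K'_mul_K i)) (KK' i j)
  have DK' : ∀ j, g .D * g (.K' j) = g (.K' j) * g .D := fun j =>
    (comm' (hg _ _ (.K_mul_K' j)) (hg _ _ (.K'_mul_K j)) (hg _ _ (.D_comm j)).symm).symm
  intro a b h
  cases h with
  | K_mul_K' i =>
    simp only [comulFamily, four]
    rw [hg _ _ (.K_mul_K' i), hg' _ _ (.K_mul_K' i), one_mul]
  | K'_mul_K i =>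
    simp only [comulFamily, four]
    rw [hg _ _ (.K'_mul_K i), hg' _ _ (.K'_mul_K i), one_mul]
  | D_mul_D' =>
    simp only [comulFamily, four]
    rw [hg _ _ .D_mul_D', hg' _ _ .D_mul_D', one_mul]
  | D'_mul_D =>
    simp only [comulFamily, four]
    rw [hg _ _ .D'_mul_D, hg' _ _ .D'_mul_D, one_mul]
  | K_comm i j =>
    simp only [comulFamily, four]
    rw [hg _ _ (.K_comm i j), hg' _ _ (.K_comm i j)]
  | D_comm i =>
    simp only [comulFamily, four]
    rw [hg _ _ (.D_comm i), hg' _ _ (.D_comm i)]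
  | K_x i j =>
    simp only [comulFamily, mul_add, add_mul, smul_add]
    congr 1
    · rw [mul_assoc, swap0, ← mul_assoc, hg _ _ (.K_x i j), smul_mul_assoc, mul_assoc]
    · rw [four, four, KK', hg' _ _ (.K_x i j), mul_smul_comm]
  | K_y i j =>
    simp only [comulFamily, mul_add, add_mul, smul_add]
    congr 1
    · rw [four, four, hg _ _ (.K_y i j), hg' _ _ (.K_comm i j), smul_mul_assoc]
    · rw [mul_assoc, hg' _ _ (.K_y i j), mul_smul_comm, swap]
  | D_x i =>
    simp only [comulFamily, mul_add, add_mul, smul_add]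
    congr 1
    · rw [mul_assoc, swap0, ← mul_assoc, hg _ _ (.D_x i), smul_mul_assoc, mul_assoc]
    · rw [four, four, DK', hg' _ _ (.D_x i), mul_smul_comm]
  | D_y i =>
    simp only [comulFamily, mul_add, add_mul, smul_add]
    congr 1
    · rw [four, four, hg _ _ (.D_y i), hg' _ _ (.D_comm i), smul_mul_assoc]
    · rw [mul_assoc, hg' _ _ (.D_y i), mul_smul_comm, swap]
  | y_x i j =>
    simp only [comulFamily]
    have e1 : g (.y i) * g' (.K i) * g (.x j) = g (.y i) * g (.x j) * g' (.K i) := by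
      rw [mul_assoc, swap0, mul_assoc]
    have e2 : g (.y i) * g' (.K i) * (g (.K' j) * g' (.x j))
        = g (.K' j) * g' (.x j) * (g (.y i) * g' (.K i)) := by
      rw [four, four, K'y hg, hg' _ _ (.K_x i j), mul_smul_comm, smul_mul_assoc, cartan_comm]
    have e3 : g' (.y i) * (g (.K' j) * g' (.x j)) = g (.K' j) * (g' (.y i) * g' (.x j)) := swap ..
    have e4 : (g (.y i) * g' (.K i) + g' (.y i)) * (g (.x j) + g (.K' j) * g' (.x j))
        - (g (.x j) + g (.K' j) * g' (.x j)) * (g (.y i) * g' (.K i) + g' (.y i))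
        = (g (.y i) * g (.x j) - g (.x j) * g (.y i)) * g' (.K i)
          + g (.K' j) * (g' (.y i) * g' (.x j) - g' (.x j) * g' (.y i)) := by
      simp only [mul_add, add_mul, sub_mul, mul_sub, e1, e2, e3, swap0 (.x j) (.y i)]
      simp only [mul_assoc]
      abel
    rw [e4, hg _ _ (.y_x i j), hg' _ _ (.y_x i j)]
    split_ifs with hij
    · subst hij
      rw [smul_mul_assoc, mul_smul_comm, ← smul_add]
      congr 1
      simp only [mul_sub, sub_mul]
      abel
    · simp
  | serre_x i j hij =>
    have hQ : ∀ i' j', g (.K' i') * g' (.x i') * g (.x j')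
        = ((q : ℂ) ^ cartan i' j') • (g (.x j') * (g (.K' i') * g' (.x i'))) := by
      intro i' j'
      rw [mul_assoc, swap0, ← mul_assoc, K'x hg, smul_mul_assoc, mul_assoc]
    refine serre_add (hg _ _ (.serre_x i j hij)) ?_ ?_ ?_ ?_
    · simp only [(hc (.K' _) (.x _)).eq]
      exact serre_twist _ _ _ _ _ (hg' _ _ (.serre_x i j hij)) (hc _ _).symm (hc _ _).symm
        (hc _ _).symm (K'K' i j)
    · simpa [cartan] using hQ i i
    · simpa [cartan, hij] using hQ i j
    · simpa [cartan, hij.symm] using hQ j i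
  | serre_y i j hij =>
    have hQ : ∀ i' j', g (.y i') * g' (.K i') * g' (.y j')
        = ((q : ℂ) ^ cartan i' j') • (g' (.y j') * (g (.y i') * g' (.K i'))) := by
      intro i' j'
      rw [mul_assoc, hg' _ _ (.K_y i' j'), mul_smul_comm, swap]
    simp only [comulFamily]
    rw [add_comm (g (.y i) * _), add_comm (g (.y j) * _)]
    refine serre_add (hg' _ _ (.serre_y i j hij)) ?_ ?_ ?_ ?_
    · exact serre_twist _ _ _ _ _ (hg _ _ (.serre_y i j hij)) (hc _ _) (hc _ _)
        (hc _ _) (hg' _ _ (.K_comm i j))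
    · simpa [cartan] using hQ i i
    · simpa [cartan, hij] using hQ i j
    · simpa [cartan, hij.symm] using hQ j i

/-! ### Hopf structure, conjugation by `q ^ t`, and the completion -/

def inl (q : ℂˣ) : Uq q →ₐ[ℂ] Uq q ⊗[ℂ] Uq q := Algebra.TensorProduct.includeLeft

def inr (q : ℂˣ) : Uq q →ₐ[ℂ] Uq q ⊗[ℂ] Uq q := Algebra.TensorProduct.includeRight

theorem inl_inr_commute (a b : Uq q) : Commute (inl q a) (inr q b) := by
  change inl q a * inr q b = inr q b * inl q a
  simp [inl, inr]

/-- The comultiplication: `δ x = x ⊗ 1 + q ^ (-h) ⊗ x`, `δ y = y ⊗ q ^ h + 1 ⊗ y`, and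
`q ^ h`, `q ^ d` are group-like. -/
def comul (q : ℂˣ) : Uq q →ₐ[ℂ] Uq q ⊗[ℂ] Uq q :=
  lift (comulFamily (fun z => inl q (gen q z)) (fun z => inr q (gen q z)))
    (relations_comul (relations_map _) (relations_map _) (fun _ _ => inl_inr_commute _ _))

/-- The opposite comultiplication `δ' = σ ∘ δ`. -/
def comulOp (q : ℂˣ) : Uq q →ₐ[ℂ] Uq q ⊗[ℂ] Uq q :=
  (Algebra.TensorProduct.comm ℂ (Uq q) (Uq q)).toAlgHom.comp (comul q)

theorem gen_K_commute (i j : Fin 3) : Commute (gen q (.K i)) (gen q (.K j)) :=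
  gen_relations q _ _ (.K_comm i j)

theorem commute_inv {S : Type*} [Monoid S] {k k' a : S} (h1 : k * k' = 1) (h2 : k' * k = 1)
    (h : Commute k a) : Commute k' a := by
  calc k' * a = k' * (a * (k * k')) := by rw [h1, mul_one]
    _ = k' * (k * a) * k' := by rw [h.eq]; simp only [mul_assoc]
    _ = a * k' := by rw [← mul_assoc k', h2, one_mul]

theorem gen_K'_commute_K (i j : Fin 3) : Commute (gen q (.K' i)) (gen q (.K j)) :=
  commute_inv (gen_relations q _ _ (.K_mul_K' i)) (gen_relations q _ _ (.K'_mul_K i))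
    (gen_K_commute i j)

theorem gen_K'_commute (i j : Fin 3) : Commute (gen q (.K' i)) (gen q (.K' j)) :=
  commute_inv (gen_relations q _ _ (.K_mul_K' i)) (gen_relations q _ _ (.K'_mul_K i))
    (gen_K'_commute_K j i).symm

/-- `a ⊗ 1 ↦ q ^ (-t) (a ⊗ 1) q ^ t`: this is `x i ↦ x i ⊗ q ^ (h i)`, `y i ↦ y i ⊗ q ^ (-h i)`,
and the identity on the Cartan part. -/
def conjLeft (q : ℂˣ) : Uq q →ₐ[ℂ] Uq q ⊗[ℂ] Uq q :=
  lift (twist (fun z => inl q (gen q z)) (fun i => inr q (gen q (.K i)))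
      (fun i => inr q (gen q (.K' i))))
    (relations_twist (relations_map _)
      (fun i => by rw [← map_mul, gen_relations q _ _ (.K'_mul_K i), map_one])
      (fun _ _ => (inl_inr_commute _ _).symm) (fun _ _ => (inl_inr_commute _ _).symm)
      (fun i j => (gen_K_commute i j).map (inr q)) (fun i j => (gen_K'_commute i j).map (inr q))
      (fun i j => (gen_K'_commute_K j i).symm.map (inr q)))

/-- `1 ⊗ a ↦ q ^ (-t) (1 ⊗ a) q ^ t`: this is `x i ↦ q ^ (h i) ⊗ x i`, `y i ↦ q ^ (-h i) ⊗ y i`,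
and the identity on the Cartan part. -/
def conjRight (q : ℂˣ) : Uq q →ₐ[ℂ] Uq q ⊗[ℂ] Uq q :=
  lift (twist (fun z => inr q (gen q z)) (fun i => inl q (gen q (.K i)))
      (fun i => inl q (gen q (.K' i))))
    (relations_twist (relations_map _)
      (fun i => by rw [← map_mul, gen_relations q _ _ (.K'_mul_K i), map_one])
      (fun _ _ => inl_inr_commute _ _) (fun _ _ => inl_inr_commute _ _)
      (fun i j => (gen_K_commute i j).map (inl q)) (fun i j => (gen_K'_commute i j).map (inl q))
      (fun i j => (gen_K'_commute_K j i).symm.map (inl q)))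

theorem conj_commute_aux {a k b k' : Uq q} {r : ℂ} (h : k * a = r • (a * k))
    (h' : k' * b = r • (b * k')) :
    Commute (inl q a * inr q k') (inr q b * inl q k) := by
  change inl q a * inr q k' * (inr q b * inl q k) = inr q b * inl q k * (inl q a * inr q k')
  simp [inl, inr, h, h', TensorProduct.tmul_smul, TensorProduct.smul_tmul]

theorem conj_commute (a b : Uq q) : Commute (conjLeft q a) (conjRight q b) := by
  have hq : (q : ℂ) ≠ 0 := q.ne_zero
  have h := gen_relations q
  have Kx : ∀ i j, _ := fun i j => h _ _ (.K_x i j)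
  have Ky : ∀ i j, _ := fun i j => h _ _ (.K_y i j)
  have K'x : ∀ i j, gen q (.K' i) * gen q (.x j)
      = ((q : ℂ) ^ (-cartan i j))⁻¹ • (gen q (.x j) * gen q (.K' i)) := fun i j =>
    K'_comm_of_K (zpow_ne_zero _ hq) (h _ _ (.K_mul_K' i)) (h _ _ (.K'_mul_K i)) (Kx i j)
  have K'y : ∀ i j, gen q (.K' i) * gen q (.y j)
      = ((q : ℂ) ^ cartan i j)⁻¹ • (gen q (.y j) * gen q (.K' i)) := fun i j =>
    K'_comm_of_K (zpow_ne_zero _ hq) (h _ _ (.K_mul_K' i)) (h _ _ (.K'_mul_K i)) (Ky i j)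
  have DK' : ∀ i, Commute (gen q .D) (gen q (.K' i)) := fun i =>
    (commute_inv (h _ _ (.K_mul_K' i)) (h _ _ (.K'_mul_K i)) (h _ _ (.D_comm i)).symm).symm
  have D'K : ∀ i, Commute (gen q .D') (gen q (.K i)) := fun i =>
    commute_inv (h _ _ .D_mul_D') (h _ _ .D'_mul_D) (h _ _ (.D_comm i))
  have D'K' : ∀ i, Commute (gen q .D') (gen q (.K' i)) := fun i =>
    commute_inv (h _ _ .D_mul_D') (h _ _ .D'_mul_D) (DK' i)
  have KK := gen_K_commute (q := q)
  have K'K := gen_K'_commute_K (q := q)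
  have KK' := fun i j => (gen_K'_commute_K (q := q) i j).symm
  have K'K' := gen_K'_commute (q := q)
  have DK : ∀ i, Commute (gen q .D) (gen q (.K i)) := fun i => h _ _ (.D_comm i)
  have lr := fun a b => inl_inr_commute (q := q) a b
  refine commute_of_gen _ _ (fun z w => ?_) a b
  simp only [conjLeft, conjRight, lift_gen]
  cases z with
  | x i =>
    cases w with
    | x j => exact conj_commute_aux (Kx j i) (by rw [cartan_comm j i]; exact Kx i j)
    | y j => exact conj_commute_aux (K'x j i) (by rw [Ky, zpow_neg, inv_inv, cartan_comm])
    | K j => exact (lr _ _).mul_left ((KK i j).map (inr q))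
    | K' j => exact (lr _ _).mul_left ((KK' j i).map (inr q))
    | D => exact (lr _ _).mul_left ((DK i).symm.map (inr q))
    | D' => exact (lr _ _).mul_left ((D'K i).symm.map (inr q))
  | y i =>
    cases w with
    | x j => exact conj_commute_aux (Ky j i) (by rw [K'x, zpow_neg, inv_inv, cartan_comm])
    | y j => exact conj_commute_aux (K'y j i) (by rw [cartan_comm j i]; exact K'y i j)
    | K j => exact (lr _ _).mul_left ((K'K i j).map (inr q))
    | K' j => exact (lr _ _).mul_left ((K'K' i j).map (inr q))
    | D => exact (lr _ _).mul_left ((DK' i).symm.map (inr q))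
    | D' => exact (lr _ _).mul_left ((D'K' i).symm.map (inr q))
  | K i =>
    cases w with
    | x j => exact (lr _ _).mul_right ((KK i j).map (inl q))
    | y j => exact (lr _ _).mul_right ((KK' j i).map (inl q))
    | _ => exact lr _ _
  | K' i =>
    cases w with
    | x j => exact (lr _ _).mul_right ((K'K i j).map (inl q))
    | y j => exact (lr _ _).mul_right ((K'K' i j).map (inl q))
    | _ => exact lr _ _
  | D =>
    cases w with
    | x j => exact (lr _ _).mul_right ((DK j).map (inl q))
    | y j => exact (lr _ _).mul_right ((DK' j).map (inl q))
    | _ => exact lr _ _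
  | D' =>
    cases w with
    | x j => exact (lr _ _).mul_right ((D'K j).map (inl q))
    | y j => exact (lr _ _).mul_right ((D'K' j).map (inl q))
    | _ => exact lr _ _

/-- The automorphism `c ↦ q ^ (-t) c q ^ t` of `A ⊗ A`, where
`t = h_1 ⊗ h^1 + h_2 ⊗ h^2 + k ⊗ d + d ⊗ k` is the invariant tensor. It is determined by
`q ^ t (y i ⊗ 1) = (y i ⊗ q ^ (h i)) q ^ t`, `q ^ t (x i ⊗ 1) = (x i ⊗ q ^ (-h i)) q ^ t`,
`q ^ t (1 ⊗ y i) = (q ^ (h i) ⊗ y i) q ^ t`, `q ^ t (1 ⊗ x i) = (q ^ (-h i) ⊗ x i) q ^ t`,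
and by `q ^ t` commuting with the Cartan part. -/
def conjT (q : ℂˣ) : Uq q ⊗[ℂ] Uq q →ₐ[ℂ] Uq q ⊗[ℂ] Uq q :=
  Algebra.TensorProduct.lift (conjLeft q) (conjRight q) conj_commute

/-- Constant Laurent series. -/
def constLaurent (q : ℂˣ) : Uq q ⊗[ℂ] Uq q →ₐ[ℂ] HahnSeries ℤ (Uq q ⊗[ℂ] Uq q) :=
  { (HahnSeries.C : Uq q ⊗[ℂ] Uq q →+* HahnSeries ℤ (Uq q ⊗[ℂ] Uq q)) with
    commutes' := fun _ => rfl }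

theorem single_one_commute (n : ℤ) (c : Uq q ⊗[ℂ] Uq q) :
    Commute (HahnSeries.single n (1 : Uq q ⊗[ℂ] Uq q)) (constLaurent q c) := by
  change HahnSeries.single n _ * HahnSeries.single 0 c =
    HahnSeries.single 0 c * HahnSeries.single n _
  simp [HahnSeries.single_mul_single]

/-- The map `a ⊗ 1 ↦ s ^ (deg a) (a ⊗ 1)` to the Laurent series in a central variable `s`, where
`deg (x i) = -1`, `deg (y i) = 1` and the Cartan part has degree `0`. -/
def gradeLeft (q : ℂˣ) : Uq q →ₐ[ℂ] HahnSeries ℤ (Uq q ⊗[ℂ] Uq q) :=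
  lift (twist (fun z => (constLaurent q).comp (inl q) (gen q z))
      (fun _ => HahnSeries.single (-1) 1) (fun _ => HahnSeries.single 1 1))
    (relations_twist (relations_map _)
      (fun _ => by rw [HahnSeries.single_mul_single]; simp)
      (fun _ _ => single_one_commute _ _) (fun _ _ => single_one_commute _ _)
      (fun _ _ => Commute.refl _) (fun _ _ => Commute.refl _)
      (fun _ _ => by
        change _ * _ = _ * _
        simp [HahnSeries.single_mul_single]))

theorem grade_commute (a b : Uq q) :
    Commute (gradeLeft q a) ((constLaurent q).comp (inr q) b) := by
  refine commute_of_gen _ _ (fun z w => ?_) a b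
  have h : ∀ c, Commute (constLaurent q (inl q c)) ((constLaurent q).comp (inr q) (gen q w)) :=
    fun c => (inl_inr_commute c _).map (constLaurent q)
  simp only [gradeLeft, lift_gen]
  cases z with
  | x i => exact (h _).mul_left (single_one_commute _ _)
  | y i => exact (h _).mul_left (single_one_commute _ _)
  | _ => exact h _

/-- The map `a ⊗ b ↦ s ^ (deg a) (a ⊗ b)` from `A ⊗ A` to the Laurent series over `A ⊗ A`. The
completed tensor square of `A` is the set of series whose coefficient of `s ^ n` has degree `n` in
the left factor: the variable `s` only records the degree, so that sums of infinitely many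
components of increasing degree make sense. -/
def toLaurent (q : ℂˣ) : Uq q ⊗[ℂ] Uq q →ₐ[ℂ] HahnSeries ℤ (Uq q ⊗[ℂ] Uq q) :=
  Algebra.TensorProduct.lift (gradeLeft q) ((constLaurent q).comp (inr q)) grade_commute

/-- The map `U_q(n_+) → A`, onto the subalgebra generated by the `y i`. -/
def ofPlus (q : ℂˣ) : Nil q →ₐ[ℂ] Uq q :=
  Nil.lift (fun i => gen q (.y i)) (fun i j hij => gen_relations q _ _ (.serre_y i j hij))

/-- The map `U_q(n_-) → A`, onto the subalgebra generated by the `x i`. -/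
def ofMinus (q : ℂˣ) : Nil q →ₐ[ℂ] Uq q :=
  Nil.lift (fun i => gen q (.x i)) (fun i j hij => gen_relations q _ _ (.serre_x i j hij))

/-- The map `U_q(n_+) ⊗ U_q(n_-) → A ⊗ A`. -/
def ofPlusMinus (q : ℂˣ) : Nil q ⊗[ℂ] Nil q →ₐ[ℂ] Uq q ⊗[ℂ] Uq q :=
  Algebra.TensorProduct.map (ofPlus q) (ofMinus q)

/-! Maps to `A ⊗ A ⊗ A = (A ⊗ A) ⊗ A`. -/

abbrev Uq3 (q : ℂˣ) : Type := (Uq q ⊗[ℂ] Uq q) ⊗[ℂ] Uq q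

/-- `c ↦ c ⊗ 1`. -/
def leg12 (q : ℂˣ) : Uq q ⊗[ℂ] Uq q →ₐ[ℂ] Uq3 q := Algebra.TensorProduct.includeLeft

/-- `a ⊗ b ↦ a ⊗ 1 ⊗ b`. -/
def leg13 (q : ℂˣ) : Uq q ⊗[ℂ] Uq q →ₐ[ℂ] Uq3 q :=
  Algebra.TensorProduct.map (inl q) (AlgHom.id ℂ (Uq q))

/-- `a ⊗ b ↦ 1 ⊗ a ⊗ b`. -/
def leg23 (q : ℂˣ) : Uq q ⊗[ℂ] Uq q →ₐ[ℂ] Uq3 q :=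
  Algebra.TensorProduct.map (inr q) (AlgHom.id ℂ (Uq q))

/-- `δ ⊗ 1`. -/
def comulLeft (q : ℂˣ) : Uq q ⊗[ℂ] Uq q →ₐ[ℂ] Uq3 q :=
  Algebra.TensorProduct.map (comul q) (AlgHom.id ℂ (Uq q))

/-- `1 ⊗ δ`. -/
def comulRight (q : ℂˣ) : Uq q ⊗[ℂ] Uq q →ₐ[ℂ] Uq3 q :=
  (Algebra.TensorProduct.assoc ℂ ℂ ℂ (Uq q) (Uq q) (Uq q)).symm.toAlgHom.comp
    (Algebra.TensorProduct.map (AlgHom.id ℂ (Uq q)) (comul q))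

/-- Conjugation `c ↦ q ^ (-t_12) c q ^ (t_12)` of `A ⊗ A ⊗ A`. -/
def conjT12 (q : ℂˣ) : Uq3 q →ₐ[ℂ] Uq3 q :=
  Algebra.TensorProduct.map (conjT q) (AlgHom.id ℂ (Uq q))

/-- Conjugation `c ↦ q ^ (-t_23) c q ^ (t_23)` of `A ⊗ A ⊗ A`. -/
def conjT23 (q : ℂˣ) : Uq3 q →ₐ[ℂ] Uq3 q :=
  (Algebra.TensorProduct.assoc ℂ ℂ ℂ (Uq q) (Uq q) (Uq q)).symm.toAlgHom.comp
    ((Algebra.TensorProduct.map (AlgHom.id ℂ (Uq q)) (conjT q)).comp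
      (Algebra.TensorProduct.assoc ℂ ℂ ℂ (Uq q) (Uq q) (Uq q)).toAlgHom)

end Uq

open Uq in
/-- `R` is the reduced universal `R`-matrix of `A = U_q(sl_3^)`: the formal power series
`R = 1 + …` in the `y i ⊗ 1` and the `1 ⊗ x i` such that `q ^ t R` is the universal `R`-matrix.

A formal power series is given by its components: the coefficient of `s ^ n` in `R` is the
component of degree `n` in the `y i ⊗ 1`; it has the same degree `n` in the `1 ⊗ x i`, since the
universal `R`-matrix commutes with `δ(h i)` and `δ(d)` and so has weight zero.

The three defining relations of the universal `R`-matrix `q ^ t R` are written with the factors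
`q ^ t` moved to the left and cancelled, by means of `conjT`; here
`(δ ⊗ 1) q ^ t = q ^ (t_13) q ^ (t_23)` and `(1 ⊗ δ) q ^ t = q ^ (t_13) q ^ (t_12)`, as the elements
of the Cartan subalgebra are primitive. -/
structure IsReducedRMatrix (q : ℂˣ) (R : PowerSeries (Nil q ⊗[ℂ] Nil q)) : Prop where
  /-- `R` is a formal power series in the `y i ⊗ 1` and the `1 ⊗ x i`. -/
  homogeneous : ∀ n, PowerSeries.coeff n R ∈ Nil.bidegree q n
  /-- The constant term is `1`. -/
  constant : PowerSeries.coeff 0 R = 1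
  /-- `δ'(a) (q ^ t R) = (q ^ t R) δ(a)`. -/
  intertwine : ∀ a : Uq q,
    toLaurent q (conjT q (comulOp q a)) *
        HahnSeries.ofPowerSeries ℤ _ (PowerSeries.map (ofPlusMinus q).toRingHom R) =
      HahnSeries.ofPowerSeries ℤ _ (PowerSeries.map (ofPlusMinus q).toRingHom R) *
        toLaurent q (comul q a)
  /-- `(δ ⊗ 1) (q ^ t R) = (q ^ t R)_13 (q ^ t R)_23`. -/
  hexagon_left :
    PowerSeries.map ((comulLeft q).comp (ofPlusMinus q)).toRingHom R =
      PowerSeries.map (((conjT23 q).comp (leg13 q)).comp (ofPlusMinus q)).toRingHom R *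
        PowerSeries.map ((leg23 q).comp (ofPlusMinus q)).toRingHom R
  /-- `(1 ⊗ δ) (q ^ t R) = (q ^ t R)_13 (q ^ t R)_12`. -/
  hexagon_right :
    PowerSeries.map ((comulRight q).comp (ofPlusMinus q)).toRingHom R =
      PowerSeries.map (((conjT12 q).comp (leg13 q)).comp (ofPlusMinus q)).toRingHom R *
        PowerSeries.map ((leg12 q).comp (ofPlusMinus q)).toRingHom R

/-- Realization of a formal power series in the `y i ⊗ 1` and `1 ⊗ x i` for elements `x i` of an
algebra `C` that satisfy the Serre relations: the image of `R` in the completion of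
`U_q(n_+) ⊗ C` with respect to the degree in the `y i`. The coefficient of `s ^ n` is the component
of degree `n` in the `y i`. -/
def realize {q : ℂˣ} {C : Type*} [Ring C] [Algebra ℂ C] (x : Fin 3 → C) (hx : Serre q x)
    (R : PowerSeries (Nil q ⊗[ℂ] Nil q)) : PowerSeries (Nil q ⊗[ℂ] C) :=
  PowerSeries.map
    (Algebra.TensorProduct.map (AlgHom.id ℂ (Nil q)) (Nil.lift x hx)).toRingHom R

/-- The element `1 ⊗ c` of the completion of `U_q(n_+) ⊗ C`. -/
def oneTensor (q : ℂˣ) {C : Type*} [Ring C] [Algebra ℂ C] (c : C) : PowerSeries (Nil q ⊗[ℂ] C) :=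
  PowerSeries.monomial 0 ((1 : Nil q) ⊗ₜ[ℂ] c)

/-- The element `∑ i, y i ⊗ c i` of the completion of `U_q(n_+) ⊗ C`; it has degree one. -/
def sumTensor (q : ℂˣ) {C : Type*} [Ring C] [Algebra ℂ C] (c : Fin 3 → C) :
    PowerSeries (Nil q ⊗[ℂ] C) :=
  PowerSeries.monomial 1 (∑ i, Nil.gen q i ⊗ₜ[ℂ] c i)

end AffineSl3

end

noncomputable section

namespace AffineSl3

/-! Both sides of the identity are governed by the same skew derivations of the algebra `Nil q`. Let
κ_i scale `gen q j` by q^(-a_ij), put r = (q - q⁻¹)⁻¹, and let P_i, P'_i be the maps that kill 1 and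
satisfy P_i(x_j u) = x_j P_i(u) + δ_ij κ_i(u), P'_i(x_j u) = x_j P'_i(u) + δ_ij κ_i⁻¹(u). These are
`skewDer q q` and `skewDer q q⁻¹`.

On the side of C, the commutator with I is a derivation. Moving A_i and B_i to the right through a
word v in the x_j produces κ_i⁻¹ and κ_i, so [I, v] = r ∑ (P'_i(v) A_i - P_i(v) B_i); this is
`commutator_lift`.

On the side of the R-matrix, intertwining for y_i, in degree n + 1, says that [1 ⊗ y_i, R_(n+1)] =
R_n (y_i ⊗ q^(h_i)) - (y_i ⊗ q^(-h_i)) R_n in A ⊗ A. To bring this down to `Nil q ⊗ Nil q`, both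
sides act on an extremal vector 1 ⊗ 1. In the first factor the y_i act by left multiplication
(`vermaSwap`). In the second the x_i do, while y_i acts as r (l P_i - l⁻¹ P'_i) and kills 1
(`verma`). Since the weight l is arbitrary, the powers l and l⁻¹ separate (`map_skewDer`): r (1 ⊗
P_i) R_(n+1) = R_n (y_i ⊗ 1) and r (1 ⊗ P'_i) R_(n+1) = (y_i ⊗ 1) (1 ⊗ κ_i⁻¹)(R_n).

Substituting these into the formula for [1 ⊗ I, R_(n+1)], and moving A_i back to the left, which
undoes κ_i⁻¹, gives the theorem degree by degree. -/

theorem qTwo_inv (q : ℂˣ) : qTwo q⁻¹ = qTwo q := by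
  simp [qTwo, add_comm]

/-! ### Scalings and skew derivations of the algebra with Serre relations -/

namespace Nil

variable {q : ℂˣ}

/-- The quotient map from the free algebra. -/
def mk (q : ℂˣ) : FreeAlgebra ℂ (Fin 3) →ₐ[ℂ] Nil q := RingQuot.mkAlgHom ℂ (NilRel q)

theorem serre_gen (q : ℂˣ) : Serre q (gen q) := by
  intro i j hij
  have h : mk q _ = mk q _ := RingQuot.mkAlgHom_rel ℂ (NilRel.serre (q := q) i j hij)
  simp only [map_add, map_sub, map_mul, map_smul, map_pow, map_zero] at h
  exact h

theorem algHom_ext {S : Type*} [Ring S] [Algebra ℂ S] {f f' : Nil q →ₐ[ℂ] S}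
    (h : ∀ i, f (gen q i) = f' (gen q i)) : f = f' :=
  RingQuot.ringQuot_ext' ℂ _ _ (FreeAlgebra.hom_ext (funext h))

/-- Induction on words, adding a generator on the left. -/
theorem induction_left {p : Nil q → Prop} (one : p 1) (add : ∀ u v, p u → p v → p (u + v))
    (smul : ∀ (c : ℂ) u, p u → p (c • u)) (gen_mul : ∀ i u, p u → p (gen q i * u)) (u : Nil q) :
    p u := by
  -- Induction in the free algebra yields products of arbitrary elements, so the claim is
  -- strengthened to stability of `p` under left multiplication by any `u`.
  have key : ∀ u v : Nil q, p v → p (u * v) := by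
    intro u
    obtain ⟨a, rfl⟩ : ∃ a, mk q a = u := RingQuot.mkAlgHom_surjective ℂ _ u
    induction a using FreeAlgebra.induction with
    | grade0 r =>
      intro v hv
      rw [AlgHom.commutes, ← Algebra.smul_def]
      exact smul r v hv
    | grade1 z => exact fun v hv => gen_mul z v hv
    | mul a b ha hb =>
      intro v hv
      rw [map_mul, mul_assoc]
      exact ha _ (hb v hv)
    | add a b ha hb =>
      intro v hv
      rw [map_add, add_mul]
      exact add _ _ (ha v hv) (hb v hv)
  simpa using key u 1 one

/-- A linear map that kills `1` and commutes with the generators up to scalars vanishes. -/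
theorem eq_zero_of_commute {T : Module.End ℂ (Nil q)} (c : Fin 3 → ℂ) (h1 : T 1 = 0)
    (h : ∀ i u, T (gen q i * u) = c i • (gen q i * T u)) : T = 0 := by
  ext u
  induction u using induction_left with
  | one => simpa using h1
  | add u v hu hv => simp_all
  | smul r u hu => simp_all
  | gen_mul i u hu => simp_all

/-- The endomorphism multiplying the generator `gen q i` by `c i`. -/
def scale (q : ℂˣ) (c : Fin 3 → ℂ) : Nil q →ₐ[ℂ] Nil q :=
  lift (fun i => c i • gen q i) (by
    intro i j hij
    -- The Serre relation is homogeneous: twice in `i`, once in `j`.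
    have h := congrArg (fun z => (c i ^ 2 * c j) • z) (serre_gen q i j hij)
    simp only [smul_zero, smul_add, smul_sub] at h
    rw [← h]
    simp only [smul_pow, smul_mul_smul_comm, smul_smul]
    match_scalars <;> ring)

@[simp]
theorem scale_gen (c : Fin 3 → ℂ) (i : Fin 3) : scale q c (gen q i) = c i • gen q i :=
  lift_gen ..

theorem scale_scale (c d : Fin 3 → ℂ) (u : Nil q) :
    scale q c (scale q d u) = scale q (c * d) u := by
  have : (scale q c).comp (scale q d) = scale q (c * d) :=
    algHom_ext fun i => by simp [smul_smul, mul_comm]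
  exact DFunLike.congr_fun this u

theorem scale_one (u : Nil q) : scale q 1 u = u := by
  have : scale q 1 = AlgHom.id ℂ (Nil q) := algHom_ext fun i => by simp
  exact DFunLike.congr_fun this u

/-- The weights `p ^ (-a i j)` of the generators under `q ^ (h i)`. -/
def weight (p : ℂˣ) (i j : Fin 3) : ℂ := (p : ℂ) ^ (-cartan i j)

theorem weight_inv (p : ℂˣ) (i j : Fin 3) : weight p⁻¹ i j = (p : ℂ) ^ cartan i j := by
  simp [weight]

theorem weight_mul_weight_inv (p : ℂˣ) (i : Fin 3) : weight p i * weight p⁻¹ i = 1 := by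
  funext j
  simp [weight, zpow_ne_zero _ p.ne_zero]

/-- The algebra map whose upper right entry is a skew derivation. -/
def skewHom (q p : ℂˣ) (hp : qTwo p = qTwo q) (k : Fin 3) :
    Nil q →ₐ[ℂ] Matrix (Fin 2) (Fin 2) (Nil q) :=
  lift (fun j => !![gen q j, if j = k then 1 else 0; 0, weight p k j • gen q j]) (by
    intro i j hij
    have h := serre_gen q i j hij
    have h' := congrArg (scale q (weight p k)) h
    simp only [map_add, map_sub, map_mul, map_smul, map_pow, map_zero, scale_gen] at h'
    -- The relations depend on q only through `qTwo q`, so they can be expressed through p, in which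
    -- the weights are powers. This covers p = q and p = q⁻¹ together.
    rw [← hp] at h h' ⊢
    have hp0 : (p : ℂ) ≠ 0 := p.ne_zero
    simp only [pow_two] at h h' ⊢
    simp only [Matrix.mul_fin_two, Matrix.smul_of, Matrix.smul_cons, Matrix.smul_empty,
      Matrix.of_add_of, Matrix.of_sub_of, Matrix.add_cons, Matrix.sub_cons]
    ext a b
    fin_cases a <;> fin_cases b
    · simpa using h
    -- The upper right entry is the skew derivation of the Serre element. For k = i the coefficients
    -- of both quadratic monomials cancel; for k = j the condition is 1 - (p + p⁻¹) p + p² = 0;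
    -- otherwise every term vanishes.
    · by_cases hi : i = k
      · subst hi
        simp [hij.symm, weight, cartan, hij]
        simp only [smul_smul, qTwo, ← mul_assoc, add_mul, mul_add, smul_mul_assoc, mul_smul_comm]
        match_scalars <;> field_simp <;> ring
      · by_cases hj : j = k
        · subst hj
          simp [hij.symm, weight, cartan, hij]
          simp only [smul_smul, qTwo]
          match_scalars
          field_simp
          ring
        · simp [hi, hj]
    · simp
    · simpa using h')

theorem skewHom_gen (p : ℂˣ) (hp : qTwo p = qTwo q) (k j : Fin 3) :
    skewHom q p hp k (gen q j) =
      !![gen q j, if j = k then 1 else 0; 0, weight p k j • gen q j] :=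
  lift_gen ..

theorem skewHom_diag (p : ℂˣ) (hp : qTwo p = qTwo q) (k : Fin 3) (u : Nil q) :
    skewHom q p hp k u 0 0 = u ∧ skewHom q p hp k u 1 0 = 0 ∧
      skewHom q p hp k u 1 1 = scale q (weight p k) u := by
  induction u using induction_left with
  | one => simp
  | add u v hu hv => simp [hu, hv]
  | smul r u hu => simp [hu]
  | gen_mul i u hu => simp [skewHom_gen, Matrix.mul_apply, Fin.sum_univ_two, hu]

/-- The skew derivation `P` with `P (gen q j * u) = gen q j * P u + δ_{jk} κ u`, where `κ` is the
scaling by `weight p k`. -/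
def skewDer (q p : ℂˣ) (hp : qTwo p = qTwo q) (k : Fin 3) : Module.End ℂ (Nil q) where
  toFun u := skewHom q p hp k u 0 1
  map_add' := by simp
  map_smul' := by simp

@[simp]
theorem skewDer_one (p : ℂˣ) (hp : qTwo p = qTwo q) (k : Fin 3) : skewDer q p hp k 1 = 0 := by
  simp [skewDer]

/-- Upper right entry of a product of triangular matrices. Together with the value 0 at 1, this
recursion determines the skew derivation. -/
theorem skewDer_gen_mul (p : ℂˣ) (hp : qTwo p = qTwo q) (k j : Fin 3) (u : Nil q) :
    skewDer q p hp k (gen q j * u) =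
      gen q j * skewDer q p hp k u + if j = k then scale q (weight p k) u else 0 := by
  simp [skewDer, skewHom_gen, Matrix.mul_apply, Fin.sum_univ_two, skewHom_diag p hp k u]

end Nil

/-! ### Serre elements commute with the opposite generators -/

section SerreCommutator

variable {S : Type*} [Ring S] [Algebra ℂ S]

/-- Here x is the partner of the repeated generator a. Ordering every monomial with x, then a and b,
then k, k' leaves commutator terms whose coefficients cancel because of the q-number `qTwo q`. -/
theorem serre_commute_left (q : ℂˣ) {a b x k k' : S} {r : ℂ}
    (hax : a * x = x * a + r • (k - k')) (hbx : b * x = x * b)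
    (hka : k * a = ((q : ℂ) ^ (2 : ℤ)) • (a * k)) (hkb : k * b = ((q : ℂ) ^ (-1 : ℤ)) • (b * k))
    (hk'a : k' * a = ((q : ℂ) ^ (-2 : ℤ)) • (a * k'))
    (hk'b : k' * b = ((q : ℂ) ^ (1 : ℤ)) • (b * k')) :
    (a ^ 2 * b - qTwo q • (a * b * a) + b * a ^ 2) * x =
      x * (a ^ 2 * b - qTwo q • (a * b * a) + b * a ^ 2) := by
  have hq : (q : ℂ) ≠ 0 := q.ne_zero
  have assoc' : ∀ {m n : S} {s : S}, m * n = s → ∀ t, m * (n * t) = s * t :=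
    fun h t => by rw [← mul_assoc, h]
  have hax' := assoc' hax
  have hbx' := assoc' hbx
  have hka' := assoc' hka
  have hkb' := assoc' hkb
  have hk'a' := assoc' hk'a
  have hk'b' := assoc' hk'b
  simp only [pow_two, add_mul, sub_mul, mul_add, mul_sub, mul_assoc, hax, hbx, hka, hkb, hk'a,
    hk'b, hax', hbx', hka', hkb', hk'a', hk'b', mul_smul_comm, smul_mul_assoc, smul_smul, qTwo,
    smul_add, smul_sub]
  match_scalars <;> simp only [zpow_neg, zpow_one, zpow_two] <;> field_simp <;> ring

/-- Here x is the partner of the single generator b; the commutator terms are multiples of a² k and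
a² k', and both coefficients vanish. -/
theorem serre_commute_right (q : ℂˣ) {a b x k k' : S} {r : ℂ}
    (hax : a * x = x * a) (hbx : b * x = x * b + r • (k - k'))
    (hka : k * a = ((q : ℂ) ^ (-1 : ℤ)) • (a * k))
    (hk'a : k' * a = ((q : ℂ) ^ (1 : ℤ)) • (a * k')) :
    (a ^ 2 * b - qTwo q • (a * b * a) + b * a ^ 2) * x =
      x * (a ^ 2 * b - qTwo q • (a * b * a) + b * a ^ 2) := by
  have hq : (q : ℂ) ≠ 0 := q.ne_zero
  have assoc' : ∀ {m n : S} {s : S}, m * n = s → ∀ t, m * (n * t) = s * t :=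
    fun h t => by rw [← mul_assoc, h]
  have hax' := assoc' hax
  have hbx' := assoc' hbx
  have hka' := assoc' hka
  have hk'a' := assoc' hk'a
  simp only [pow_two, add_mul, sub_mul, mul_add, mul_sub, mul_assoc, hax, hbx, hka, hk'a,
    hax', hbx', hka', hk'a', mul_smul_comm, smul_mul_assoc, smul_smul, qTwo,
    smul_add, smul_sub]
  match_scalars <;> simp only [zpow_neg, zpow_one] <;> field_simp <;> ring

theorem serre_commute {q : ℂˣ} {a b x : S} (hax : a * x = x * a) (hbx : b * x = x * b) :
    (a ^ 2 * b - qTwo q • (a * b * a) + b * a ^ 2) * x =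
      x * (a ^ 2 * b - qTwo q • (a * b * a) + b * a ^ 2) := by
  have ha : Commute a x := hax
  have hb : Commute b x := hbx
  exact (((ha.pow_left 2).mul_left hb).sub_left
    (((ha.mul_left hb).mul_left ha).smul_left _)).add_left (hb.mul_left (ha.pow_left 2))

end SerreCommutator

/-- The operators of the lowest weight module on `Nil q` of weight `l` in which the `x i` act by
left multiplication. -/
def vermaFamily (q l : ℂˣ) : Gen → Module.End ℂ (Nil q)
  | .x i => LinearMap.mulLeft ℂ (Nil.gen q i)
  | .y i => ((q : ℂ) - (q : ℂ)⁻¹)⁻¹ • ((l : ℂ) • Nil.skewDer q q rfl i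
      - (l : ℂ)⁻¹ • Nil.skewDer q q⁻¹ (qTwo_inv q) i)
  | .K i => (l : ℂ) • (Nil.scale q (Nil.weight q i)).toLinearMap
  | .K' i => (l : ℂ)⁻¹ • (Nil.scale q (Nil.weight q⁻¹ i)).toLinearMap
  | .D => (Nil.scale q (fun i => if i = 2 then (q : ℂ)⁻¹ else 1)).toLinearMap
  | .D' => (Nil.scale q (fun i => if i = 2 then (q : ℂ) else 1)).toLinearMap

/-! ### The extremal weight modules on `Nil q` -/

section Verma

variable (q l : ℂˣ)

theorem vermaFamily_y_one (i : Fin 3) : vermaFamily q l (.y i) 1 = 0 := by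
  simp [vermaFamily]

/-- The common part of the two skew derivations commutes with left multiplication, and the
inhomogeneous terms l κ_i and l⁻¹ κ_i⁻¹ are exactly the actions of q^(h_i) and q^(-h_i). -/
theorem vermaFamily_y_mul_x (i j : Fin 3) :
    vermaFamily q l (.y i) * vermaFamily q l (.x j) =
      vermaFamily q l (.x j) * vermaFamily q l (.y i) +
        if j = i then ((q : ℂ) - (q : ℂ)⁻¹)⁻¹ •
          (vermaFamily q l (.K i) - vermaFamily q l (.K' i)) else 0 := by
  ext u
  simp only [vermaFamily, Module.End.mul_apply, LinearMap.mulLeft_apply, LinearMap.smul_apply,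
    LinearMap.sub_apply, LinearMap.add_apply, Nil.skewDer_gen_mul]
  split_ifs
  · simp only [LinearMap.smul_apply, LinearMap.sub_apply, AlgHom.toLinearMap_apply, mul_sub,
      mul_smul_comm, smul_add, smul_sub]
    abel
  · simp only [add_zero, LinearMap.zero_apply, mul_sub, mul_smul_comm]

theorem vermaFamily_K_mul_x (i j : Fin 3) :
    vermaFamily q l (.K i) * vermaFamily q l (.x j) =
      ((q : ℂ) ^ (-cartan i j)) • (vermaFamily q l (.x j) * vermaFamily q l (.K i)) := by
  ext u
  simp [vermaFamily, Nil.weight, smul_smul, mul_comm]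

theorem vermaFamily_D_mul_x (i : Fin 3) :
    vermaFamily q l .D * vermaFamily q l (.x i) =
      (if i = 2 then (q : ℂ)⁻¹ else 1) • (vermaFamily q l (.x i) * vermaFamily q l .D) := by
  ext u
  split_ifs with hi <;> simp [vermaFamily, hi]

theorem vermaFamily_K_mul_K (i j : Fin 3) :
    vermaFamily q l (.K i) * vermaFamily q l (.K j) =
      vermaFamily q l (.K j) * vermaFamily q l (.K i) := by
  ext u
  simp [vermaFamily, Nil.scale_scale, mul_comm]

theorem vermaFamily_K_mul_K' (i j : Fin 3) :
    vermaFamily q l (.K i) * vermaFamily q l (.K' j) =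
      vermaFamily q l (.K' j) * vermaFamily q l (.K i) := by
  ext u
  simp [vermaFamily, Nil.scale_scale, mul_comm]

theorem vermaFamily_D_mul_K (i : Fin 3) :
    vermaFamily q l .D * vermaFamily q l (.K i) =
      vermaFamily q l (.K i) * vermaFamily q l .D := by
  ext u
  simp [vermaFamily, Nil.scale_scale, mul_comm]

theorem vermaFamily_D_mul_K' (i : Fin 3) :
    vermaFamily q l .D * vermaFamily q l (.K' i) =
      vermaFamily q l (.K' i) * vermaFamily q l .D := by
  ext u
  simp [vermaFamily, Nil.scale_scale, mul_comm]

theorem vermaFamily_K_mul_K'_self (i : Fin 3) :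
    vermaFamily q l (.K i) * vermaFamily q l (.K' i) = 1 := by
  ext u
  simp [vermaFamily, Nil.scale_scale, Nil.weight_mul_weight_inv, Nil.scale_one]

theorem vermaFamily_K'_mul_K_self (i : Fin 3) :
    vermaFamily q l (.K' i) * vermaFamily q l (.K i) = 1 := by
  rw [← vermaFamily_K_mul_K', vermaFamily_K_mul_K'_self]

variable {q l}

/-- If `k` scales the `x i` and commutes with the `[y j, x j]`, then it scales the `y j`. -/
theorem vermaFamily_mul_y {k : Module.End ℂ (Nil q)} {c d : Fin 3 → ℂ} (hcd : ∀ i, d i * c i = 1)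
    (one : ∃ t : ℂ, k 1 = t • 1)
    (x : ∀ i, k * vermaFamily q l (.x i) = c i • (vermaFamily q l (.x i) * k))
    (K : ∀ i, k * vermaFamily q l (.K i) = vermaFamily q l (.K i) * k)
    (K' : ∀ i, k * vermaFamily q l (.K' i) = vermaFamily q l (.K' i) * k) (j : Fin 3) :
    k * vermaFamily q l (.y j) = d j • (vermaFamily q l (.y j) * k) := by
  rw [← sub_eq_zero]
  -- The defect kills 1, because `y j` does and k only rescales 1. It remains to see that it passes
  -- the `x i` with factor c_i.
  refine Nil.eq_zero_of_commute c ?_ fun i u => ?_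
  · obtain ⟨t, ht⟩ := one
    simp [vermaFamily_y_one, ht]
  · have e : (k * vermaFamily q l (.y j) - d j • (vermaFamily q l (.y j) * k)) *
        vermaFamily q l (.x i) = c i • (vermaFamily q l (.x i) *
          (k * vermaFamily q l (.y j) - d j • (vermaFamily q l (.y j) * k))) := by
      rw [sub_mul, smul_mul_assoc, mul_assoc, mul_assoc, x, vermaFamily_y_mul_x, mul_add,
        ← mul_assoc, x, mul_smul_comm, ← mul_assoc (vermaFamily q l (.y j)), vermaFamily_y_mul_x]
      split_ifs with hij
      · subst hij
        -- The extra terms coming from [y_i, x_i] cancel: k commutes with `K` and `K'`, and d_i c_i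
        -- = 1.
        have hcd' : ∀ t, d i * (c i * t) = t := fun t => by rw [← mul_assoc, hcd, one_mul]
        simp only [add_mul, smul_add, mul_smul_comm, smul_mul_assoc, mul_sub, sub_mul,
          mul_assoc, K, K', smul_sub, smul_smul, hcd, hcd']
        rw [mul_comm (c i) (d i), hcd]
        abel
      · simp only [add_zero, mul_zero, smul_sub, mul_sub, mul_smul_comm, smul_mul_assoc,
          mul_assoc, smul_smul, mul_comm]
    exact DFunLike.congr_fun e u

variable (q l)

theorem vermaFamily_K_mul_y (i j : Fin 3) :
    vermaFamily q l (.K i) * vermaFamily q l (.y j) =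
      ((q : ℂ) ^ cartan i j) • (vermaFamily q l (.y j) * vermaFamily q l (.K i)) :=
  vermaFamily_mul_y (d := fun j => (q : ℂ) ^ cartan i j) (c := fun j => (q : ℂ) ^ (-cartan i j))
    (fun j => by simp [zpow_ne_zero _ q.ne_zero]) ⟨l, by simp [vermaFamily]⟩
    (vermaFamily_K_mul_x q l i) (vermaFamily_K_mul_K q l i) (vermaFamily_K_mul_K' q l i) j

theorem vermaFamily_K'_mul_y (i j : Fin 3) :
    vermaFamily q l (.K' i) * vermaFamily q l (.y j) =
      ((q : ℂ) ^ (-cartan i j)) • (vermaFamily q l (.y j) * vermaFamily q l (.K' i)) := by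
  rw [zpow_neg]
  exact Uq.K'_comm_of_K (zpow_ne_zero _ q.ne_zero) (vermaFamily_K_mul_K'_self q l i)
    (vermaFamily_K'_mul_K_self q l i) (vermaFamily_K_mul_y q l i j)

theorem vermaFamily_D_mul_y (j : Fin 3) :
    vermaFamily q l .D * vermaFamily q l (.y j) =
      (if j = 2 then (q : ℂ) else 1) • (vermaFamily q l (.y j) * vermaFamily q l .D) :=
  vermaFamily_mul_y (d := fun j => if j = 2 then (q : ℂ) else 1)
    (c := fun j => if j = 2 then (q : ℂ)⁻¹ else 1)
    (fun j => by split_ifs <;> simp) ⟨1, by simp [vermaFamily]⟩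
    (vermaFamily_D_mul_x q l) (vermaFamily_D_mul_K q l) (vermaFamily_D_mul_K' q l) j

/-- The Serre element in the y's kills the extremal vector 1 and commutes with every `x k`, hence
vanishes on all words. No direct computation with skew derivations is needed. -/
theorem vermaFamily_serre_y (i j : Fin 3) (hij : i ≠ j) :
    vermaFamily q l (.y i) ^ 2 * vermaFamily q l (.y j)
        - qTwo q • (vermaFamily q l (.y i) * vermaFamily q l (.y j) * vermaFamily q l (.y i))
        + vermaFamily q l (.y j) * vermaFamily q l (.y i) ^ 2 = 0 := by
  refine Nil.eq_zero_of_commute 1 ?_ fun k u => ?_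
  · simp [vermaFamily_y_one, pow_two]
  · rw [Pi.one_apply, one_smul]
    have hx := fun i => vermaFamily_y_mul_x q l i k
    have e : (vermaFamily q l (.y i) ^ 2 * vermaFamily q l (.y j)
        - qTwo q • (vermaFamily q l (.y i) * vermaFamily q l (.y j) * vermaFamily q l (.y i))
        + vermaFamily q l (.y j) * vermaFamily q l (.y i) ^ 2) * vermaFamily q l (.x k) =
        vermaFamily q l (.x k) * (vermaFamily q l (.y i) ^ 2 * vermaFamily q l (.y j)
        - qTwo q • (vermaFamily q l (.y i) * vermaFamily q l (.y j) * vermaFamily q l (.y i))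
        + vermaFamily q l (.y j) * vermaFamily q l (.y i) ^ 2) := by
      by_cases hi : k = i
      · subst hi
        refine serre_commute_left q (by simpa using hx k) (by simpa [hij] using hx j)
          ?_ ?_ ?_ ?_
        · simpa [cartan] using vermaFamily_K_mul_y q l k k
        · simpa [cartan, hij] using vermaFamily_K_mul_y q l k j
        · simpa [cartan] using vermaFamily_K'_mul_y q l k k
        · simpa [cartan, hij] using vermaFamily_K'_mul_y q l k j
      · by_cases hj : k = j
        · subst hj
          refine serre_commute_right q (by simpa [hi] using hx i) (by simpa using hx k) ?_ ?_
          · simpa [cartan, hij.symm] using vermaFamily_K_mul_y q l k i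
          · simpa [cartan, hij.symm] using vermaFamily_K'_mul_y q l k i
        · exact serre_commute (by simpa [hi] using hx i) (by simpa [hj] using hx j)
    exact DFunLike.congr_fun e u

theorem vermaFamily_relations : UqRelations q (vermaFamily q l) := by
  intro a b h
  cases h with
  | K_mul_K' i => exact vermaFamily_K_mul_K'_self q l i
  | K'_mul_K i => exact vermaFamily_K'_mul_K_self q l i
  | D_mul_D' =>
    ext u
    have : (fun i : Fin 3 => if i = 2 then (q : ℂ)⁻¹ else 1) *
        (fun i : Fin 3 => if i = 2 then (q : ℂ) else 1) = 1 := by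
      funext i
      simp only [Pi.mul_apply, Pi.one_apply]
      split_ifs <;> simp
    simp [vermaFamily, Nil.scale_scale, this, Nil.scale_one]
  | D'_mul_D =>
    ext u
    have : (fun i : Fin 3 => if i = 2 then (q : ℂ) else 1) *
        (fun i : Fin 3 => if i = 2 then (q : ℂ)⁻¹ else 1) = 1 := by
      funext i
      simp only [Pi.mul_apply, Pi.one_apply]
      split_ifs <;> simp
    simp [vermaFamily, Nil.scale_scale, this, Nil.scale_one]
  | K_comm i j => exact vermaFamily_K_mul_K q l i j
  | D_comm i => exact vermaFamily_D_mul_K q l i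
  | K_x i j => exact vermaFamily_K_mul_x q l i j
  | K_y i j => exact vermaFamily_K_mul_y q l i j
  | D_x i => exact vermaFamily_D_mul_x q l i
  | D_y i => exact vermaFamily_D_mul_y q l i
  | y_x i j =>
    rw [vermaFamily_y_mul_x, add_sub_cancel_left]
    simp only [eq_comm]
  | serre_x i j hij =>
    ext u
    have h := congrArg (· * u) (Nil.serre_gen q i j hij)
    simpa [vermaFamily, add_mul, sub_mul, pow_two, mul_assoc] using h
  | serre_y i j hij => exact vermaFamily_serre_y q l i j hij

/-- The lowest weight module, with `x i` acting by left multiplication. -/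
def verma : Uq q →ₐ[ℂ] Module.End ℂ (Nil q) := Uq.lift _ (vermaFamily_relations q l)

/-- The generators after exchanging the `x i` with the `y i` and inverting the Cartan part. -/
def swapGen : Gen → Gen
  | .x i => .y i
  | .y i => .x i
  | .K i => .K' i
  | .K' i => .K i
  | .D => .D'
  | .D' => .D

/-- The Chevalley involution: it turns the lowest weight module into a highest weight module on
which the y_i act freely, as needed in the first tensor factor. -/
theorem relations_swap {S : Type*} [Ring S] [Algebra ℂ S] {g : Gen → S} {q : ℂˣ}
    (hg : UqRelations q g) : UqRelations q (fun z => g (swapGen z)) := by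
  have hq : (q : ℂ) ≠ 0 := q.ne_zero
  intro a b h
  cases h with
  | K_mul_K' i => exact hg _ _ (.K'_mul_K i)
  | K'_mul_K i => exact hg _ _ (.K_mul_K' i)
  | D_mul_D' => exact hg _ _ .D'_mul_D
  | D'_mul_D => exact hg _ _ .D_mul_D'
  | K_comm i j =>
    have h1 := Uq.commute_inv (hg _ _ (.K_mul_K' i)) (hg _ _ (.K'_mul_K i)) (hg _ _ (.K_comm i j))
    exact (Uq.commute_inv (hg _ _ (.K_mul_K' j)) (hg _ _ (.K'_mul_K j)) h1.symm).symm
  | D_comm i =>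
    have h1 := Uq.commute_inv (hg _ _ .D_mul_D') (hg _ _ .D'_mul_D) (hg _ _ (.D_comm i))
    exact (Uq.commute_inv (hg _ _ (.K_mul_K' i)) (hg _ _ (.K'_mul_K i)) h1.symm).symm
  | K_x i j =>
    have := Uq.K'_comm_of_K (zpow_ne_zero _ hq) (hg _ _ (.K_mul_K' i)) (hg _ _ (.K'_mul_K i))
      (hg _ _ (.K_y i j))
    simpa only [swapGen, zpow_neg] using this
  | K_y i j =>
    have := Uq.K'_comm_of_K (zpow_ne_zero _ hq) (hg _ _ (.K_mul_K' i)) (hg _ _ (.K'_mul_K i))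
      (hg _ _ (.K_x i j))
    simpa only [swapGen, zpow_neg, inv_inv] using this
  | D_x i =>
    have := Uq.K'_comm_of_K (by split_ifs <;> simp) (hg _ _ .D_mul_D') (hg _ _ .D'_mul_D)
      (hg _ _ (.D_y i))
    simpa only [swapGen, apply_ite (fun z : ℂ => z⁻¹), inv_one] using this
  | D_y i =>
    have := Uq.K'_comm_of_K (by split_ifs <;> simp) (hg _ _ .D_mul_D') (hg _ _ .D'_mul_D)
      (hg _ _ (.D_x i))
    simpa only [swapGen, apply_ite (fun z : ℂ => z⁻¹), inv_one, inv_inv] using this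
  | y_x i j =>
    simp only [swapGen]
    rw [← neg_sub, hg _ _ (.y_x j i)]
    split_ifs with h1 h2 h2
    · subst h1
      rw [← smul_neg, neg_sub]
    · exact absurd h1.symm h2
    · exact absurd h2.symm h1
    · exact neg_zero
  | serre_x i j hij => exact hg _ _ (.serre_y i j hij)
  | serre_y i j hij => exact hg _ _ (.serre_x i j hij)

/-- The highest weight module, with `y i` acting by left multiplication. -/
def vermaSwap : Uq q →ₐ[ℂ] Module.End ℂ (Nil q) :=
  Uq.lift _ (relations_swap (vermaFamily_relations q l))

end Verma

/-! ### The intertwining relation for y_i in components -/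

namespace Uq

variable {q : ℂˣ}

theorem toLaurent_inl (a : Uq q) : toLaurent q (inl q a) = gradeLeft q a := by
  simp [toLaurent, inl]

theorem toLaurent_inr (a : Uq q) : toLaurent q (inr q a) = HahnSeries.C (inr q a) := by
  simp [toLaurent, inr, constLaurent]

theorem conjT_inl (a : Uq q) : conjT q (inl q a) = conjLeft q a := by
  simp [conjT, inl]

theorem conjT_inr (a : Uq q) : conjT q (inr q a) = conjRight q a := by
  simp [conjT, inr]

theorem gradeLeft_y (i : Fin 3) :
    gradeLeft q (gen q (.y i)) = HahnSeries.C (inl q (gen q (.y i))) * HahnSeries.single 1 1 := by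
  simp [gradeLeft, lift_gen, twist, constLaurent]

theorem comul_y (i : Fin 3) : comul q (gen q (.y i)) =
    inl q (gen q (.y i)) * inr q (gen q (.K i)) + inr q (gen q (.y i)) := by
  simp [comul, lift_gen, comulFamily]

theorem comm_inl (a : Uq q) : Algebra.TensorProduct.comm ℂ (Uq q) (Uq q) (inl q a) = inr q a := by
  simp [inl, inr]

theorem comm_inr (a : Uq q) : Algebra.TensorProduct.comm ℂ (Uq q) (Uq q) (inr q a) = inl q a := by
  simp [inl, inr]

/-- In q^(h_i) ⊗ y_i + y_i ⊗ 1, conjugation multiplies the first term by q^(-h_i) ⊗ 1, cancelling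
its Cartan factor, and the second by 1 ⊗ q^(-h_i). -/
theorem conjT_comulOp_y (i : Fin 3) : conjT q (comulOp q (gen q (.y i))) =
    inl q (gen q (.y i)) * inr q (gen q (.K' i)) + inr q (gen q (.y i)) := by
  have h : comulOp q (gen q (.y i)) =
      inr q (gen q (.y i)) * inl q (gen q (.K i)) + inl q (gen q (.y i)) := by
    change Algebra.TensorProduct.comm ℂ (Uq q) (Uq q) (comul q (gen q (.y i))) = _
    rw [comul_y, map_add, map_mul, comm_inl, comm_inr, comm_inr]
  rw [h, map_add, map_mul, conjT_inr, conjT_inl, conjT_inl]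
  simp only [conjLeft, conjRight, lift_gen, twist]
  rw [mul_assoc, ← map_mul, gen_relations q _ _ (.K'_mul_K i), map_one, mul_one, add_comm]

/-- For a = y_i no negative power of s occurs, so the intertwining relation lives in power series.
-/
theorem toLaurent_y_add (i : Fin 3) (k : Uq q) :
    toLaurent q (inl q (gen q (.y i)) * inr q k + inr q (gen q (.y i))) =
      HahnSeries.ofPowerSeries ℤ _
        (PowerSeries.C (inl q (gen q (.y i)) * inr q k) * PowerSeries.X +
          PowerSeries.C (inr q (gen q (.y i)))) := by
  rw [map_add, map_mul, toLaurent_inl, toLaurent_inr, toLaurent_inr, gradeLeft_y, map_add, map_mul,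
    HahnSeries.ofPowerSeries_C, HahnSeries.ofPowerSeries_C, HahnSeries.ofPowerSeries_X, map_mul,
    mul_assoc, mul_assoc]
  congr 2
  exact single_one_commute _ _

end Uq

open Uq

variable {q : ℂˣ} {R : PowerSeries (Nil q ⊗[ℂ] Nil q)}

theorem IsReducedRMatrix.coeff_intertwine_y (hR : IsReducedRMatrix q R) (i : Fin 3) (n : ℕ) :
    inl q (gen q (.y i)) * inr q (gen q (.K' i)) * ofPlusMinus q (PowerSeries.coeff n R) +
        inr q (gen q (.y i)) * ofPlusMinus q (PowerSeries.coeff (n + 1) R) =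
      ofPlusMinus q (PowerSeries.coeff n R) * (inl q (gen q (.y i)) * inr q (gen q (.K i))) +
        ofPlusMinus q (PowerSeries.coeff (n + 1) R) * inr q (gen q (.y i)) := by
  have h := hR.intertwine (gen q (.y i))
  rw [conjT_comulOp_y, comul_y, toLaurent_y_add, toLaurent_y_add, ← map_mul, ← map_mul] at h
  -- Since y_i ⊗ 1 has degree one and 1 ⊗ y_i degree zero, the coefficient of s^(n+1) links the
  -- components n and n + 1 of `R`.
  have h' := congrArg (PowerSeries.coeff (n + 1)) (HahnSeries.ofPowerSeries_injective h)
  rw [add_mul, mul_add, mul_assoc, PowerSeries.X_mul, ← mul_assoc, ← mul_assoc,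
    map_add, map_add, PowerSeries.coeff_succ_mul_X, PowerSeries.coeff_succ_mul_X,
    PowerSeries.coeff_C_mul, PowerSeries.coeff_C_mul, PowerSeries.coeff_mul_C,
    PowerSeries.coeff_mul_C] at h'
  exact h'

theorem ofPlus_gen (i : Fin 3) : ofPlus q (Nil.gen q i) = gen q (.y i) := Nil.lift_gen ..

theorem ofMinus_gen (i : Fin 3) : ofMinus q (Nil.gen q i) = gen q (.x i) := Nil.lift_gen ..

/-! ### Evaluation on the extremal vectors -/

section Evaluation

variable (q) (l : ℂˣ)

theorem verma_ofMinus (v : Nil q) : verma q l (ofMinus q v) = LinearMap.mulLeft ℂ v := by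
  have : (verma q l).comp (ofMinus q) = Algebra.lmul ℂ (Nil q) :=
    Nil.algHom_ext fun i => by
      rw [AlgHom.comp_apply, ofMinus_gen, verma]
      exact lift_gen ..
  exact DFunLike.congr_fun this v

theorem vermaSwap_ofPlus (u : Nil q) : vermaSwap q l (ofPlus q u) = LinearMap.mulLeft ℂ u := by
  have : (vermaSwap q l).comp (ofPlus q) = Algebra.lmul ℂ (Nil q) :=
    Nil.algHom_ext fun i => by
      rw [AlgHom.comp_apply, ofPlus_gen, vermaSwap]
      exact lift_gen ..
  exact DFunLike.congr_fun this u

/-- The action of `A ⊗ A` on the extremal vector `1 ⊗ 1`. -/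
def evalOne : Uq q ⊗[ℂ] Uq q →ₗ[ℂ] Nil q ⊗[ℂ] Nil q :=
  TensorProduct.map (LinearMap.applyₗ (1 : Nil q) ∘ₗ (vermaSwap q 1).toLinearMap)
    (LinearMap.applyₗ (1 : Nil q) ∘ₗ (verma q l).toLinearMap)

theorem evalOne_tmul (a b : Uq q) :
    evalOne q l (a ⊗ₜ b) = vermaSwap q 1 a 1 ⊗ₜ verma q l b 1 := rfl

/-- With a = b = 1 this shows that `evalOne` is a left inverse of `ofPlusMinus`, so identities in A
⊗ A descend to `Nil q ⊗ Nil q` without a triangular decomposition. -/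
theorem evalOne_mul_ofPlusMinus (a b : Uq q) (z : Nil q ⊗[ℂ] Nil q) :
    evalOne q l (inl q a * inr q b * ofPlusMinus q z) =
      TensorProduct.map (vermaSwap q 1 a) (verma q l b) z := by
  induction z with
  | zero => simp
  | add z w hz hw => simp only [map_add, mul_add, hz, hw]
  | tmul u v =>
    simp [inl, inr, ofPlusMinus, evalOne_tmul, verma_ofMinus, vermaSwap_ofPlus]

theorem evalOne_ofPlusMinus_mul (u : Nil q) (b : Uq q) (z : Nil q ⊗[ℂ] Nil q) :
    evalOne q l (ofPlusMinus q z * (inl q (ofPlus q u) * inr q b)) =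
      z * (u ⊗ₜ verma q l b 1) := by
  induction z with
  | zero => simp
  | add z w hz hw => simp only [map_add, add_mul, hz, hw]
  | tmul u v =>
    simp [inl, inr, ofPlusMinus, evalOne_tmul, verma_ofMinus, vermaSwap_ofPlus]

theorem verma_gen (a : Gen) : verma q l (gen q a) = vermaFamily q l a := lift_gen ..

end Evaluation

/-- The relation for `y i`, evaluated on the extremal vector of weight `l`. -/
theorem IsReducedRMatrix.map_lowering (hR : IsReducedRMatrix q R) (l : ℂˣ) (i : Fin 3) (n : ℕ) :
    (l : ℂ)⁻¹ • TensorProduct.map (LinearMap.mulLeft ℂ (Nil.gen q i))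
          (Nil.scale q (Nil.weight q⁻¹ i)).toLinearMap (PowerSeries.coeff n R) +
        LinearMap.lTensor (Nil q) (vermaFamily q l (.y i)) (PowerSeries.coeff (n + 1) R) =
      (l : ℂ) • (PowerSeries.coeff n R * (Nil.gen q i ⊗ₜ 1)) := by
  have h := congrArg (evalOne q l) (hR.coeff_intertwine_y i n)
  have e1 := evalOne_mul_ofPlusMinus q l 1 (gen q (.y i)) (PowerSeries.coeff (n + 1) R)
  have e2 := evalOne_ofPlusMinus_mul q l 1 (gen q (.y i)) (PowerSeries.coeff (n + 1) R)
  have e3 := evalOne_mul_ofPlusMinus q l (gen q (.y i)) (gen q (.K' i)) (PowerSeries.coeff n R)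
  have e4 := evalOne_ofPlusMinus_mul q l (Nil.gen q i) (gen q (.K i)) (PowerSeries.coeff n R)
  rw [map_one, map_one, one_mul, verma_gen] at e1
  -- The term with y_i to the right of R_(n+1) disappears, since y_i kills the extremal vector of
  -- the second factor.
  rw [map_one, map_one, one_mul, verma_gen, vermaFamily_y_one, TensorProduct.tmul_zero,
    mul_zero] at e2
  rw [← ofPlus_gen, vermaSwap_ofPlus, verma_gen] at e3
  rw [verma_gen] at e4
  rw [map_add, map_add, e1, e2, ← ofPlus_gen, e3, e4, add_zero] at h
  simpa [vermaFamily, TensorProduct.map_smul_right, TensorProduct.tmul_smul,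
    Module.End.one_eq_id, LinearMap.lTensor] using h

/-- The relation is l (b - d) + l⁻¹ (a - c) = 0. Two values of l with distinct squares suffice; 1
and 2 are used. -/
theorem eq_of_smul_eq {M : Type*} [AddCommGroup M] [Module ℂ M] {a b c d : M}
    (h : ∀ l : ℂˣ, (l : ℂ)⁻¹ • a + ((l : ℂ) • b - (l : ℂ)⁻¹ • c) = (l : ℂ) • d) :
    b = d ∧ c = a := by
  have h1 := h 1
  have h2 := h (Units.mk0 2 two_ne_zero)
  simp only [Units.val_one, inv_one, one_smul, Units.val_mk0] at h1 h2
  have hd : d = a + (b - c) := h1.symm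
  have e : ((2 : ℂ) - 2⁻¹) • (c - a) = 0 := by
    rw [← sub_eq_zero] at h2
    rw [← h2, hd]
    module
  have hca : c = a := by
    rw [← sub_eq_zero]
    exact (smul_eq_zero.mp e).resolve_left (by norm_num)
  exact ⟨by rw [hd, hca]; abel, hca⟩

/-- The components of `R` do not depend on l, so the single relation `map_lowering` splits into its
l and l⁻¹ parts. -/
theorem IsReducedRMatrix.map_skewDer (hR : IsReducedRMatrix q R) (i : Fin 3)
    (n : ℕ) :
    ((q : ℂ) - (q : ℂ)⁻¹)⁻¹ • LinearMap.lTensor (Nil q) (Nil.skewDer q q rfl i)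
          (PowerSeries.coeff (n + 1) R) =
        PowerSeries.coeff n R * (Nil.gen q i ⊗ₜ 1) ∧
      ((q : ℂ) - (q : ℂ)⁻¹)⁻¹ • LinearMap.lTensor (Nil q)
          (Nil.skewDer q q⁻¹ (qTwo_inv q) i) (PowerSeries.coeff (n + 1) R) =
        TensorProduct.map (LinearMap.mulLeft ℂ (Nil.gen q i))
          (Nil.scale q (Nil.weight q⁻¹ i)).toLinearMap (PowerSeries.coeff n R) := by
  refine eq_of_smul_eq fun l => ?_
  rw [← hR.map_lowering l i n]
  congr 1
  rw [smul_comm (l : ℂ), smul_comm (l : ℂ)⁻¹, ← smul_sub]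
  simp only [vermaFamily, LinearMap.lTensor_smul, LinearMap.lTensor_sub,
    LinearMap.smul_apply, LinearMap.sub_apply]

/-! ### Commutators with I in the realization -/

section Realization

variable {C : Type*} [Ring C] [Algebra ℂ C] {x : Fin 3 → C} (hx : Serre q x)

theorem mul_lift_of_scale {c : Fin 3 → ℂ} {a : C} (h : ∀ j, a * x j = c j • (x j * a))
    (v : Nil q) : a * Nil.lift x hx v = Nil.lift x hx (Nil.scale q c v) * a := by
  induction v using Nil.induction_left with
  | one => simp
  | add u v hu hv => simp only [map_add, mul_add, add_mul, hu, hv]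
  | smul r u hu => simp only [map_smul, mul_smul_comm, smul_mul_assoc, hu]
  | gen_mul j u hu =>
    simp only [map_mul, Nil.scale_gen, Nil.lift_gen, map_smul, smul_mul_assoc, mul_assoc, ← hu]
    rw [← mul_assoc a, h, smul_mul_assoc, mul_assoc]

/-- From [I, x_j u] = [I, x_j] u + x_j [I, u], moving A_j and B_j past u gives κ_j⁻¹(u) A_j and
κ_j(u) B_j. These are the inhomogeneous terms in the recursions of the two skew derivations. -/
theorem commutator_lift {r : ℂ} {I : C} {A B : Fin 3 → C}
    (hI : ∀ i, I * x i - x i * I = r • (A i - B i))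
    (hA : ∀ i j, A i * x j = ((q : ℂ) ^ cartan i j) • (x j * A i))
    (hB : ∀ i j, B i * x j = ((q : ℂ) ^ (-cartan i j)) • (x j * B i)) (v : Nil q) :
    I * Nil.lift x hx v - Nil.lift x hx v * I =
      r • ∑ i, (Nil.lift x hx (Nil.skewDer q q⁻¹ (qTwo_inv q) i v) * A i
        - Nil.lift x hx (Nil.skewDer q q rfl i v) * B i) := by
  induction v using Nil.induction_left with
  | one => simp
  | add u v hu hv =>
    simp only [map_add, mul_add, add_mul, add_sub_add_comm, hu, hv, Finset.sum_add_distrib,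
      smul_add]
  | smul c u hu =>
    simp only [map_smul, mul_smul_comm, smul_mul_assoc, ← smul_sub, hu, ← Finset.smul_sum]
    rw [smul_comm]
  | gen_mul j u hu =>
    have hA' := mul_lift_of_scale hx (c := Nil.weight q⁻¹ j) (a := A j)
      (fun k => by rw [Nil.weight_inv]; exact hA j k) u
    have hB' := mul_lift_of_scale hx (c := Nil.weight q j) (a := B j) (hB j) u
    have e : I * (x j * Nil.lift x hx u) - x j * Nil.lift x hx u * I =
        (I * x j - x j * I) * Nil.lift x hx u
          + x j * (I * Nil.lift x hx u - Nil.lift x hx u * I) := by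
      noncomm_ring
    rw [map_mul, Nil.lift_gen, e, hu, hI, smul_mul_assoc, sub_mul, hA', hB', mul_smul_comm,
      ← smul_add, Finset.mul_sum]
    congr 1
    simp only [Nil.skewDer_gen_mul, map_add, map_mul, Nil.lift_gen, apply_ite (Nil.lift x hx),
      map_zero, add_mul, ite_mul, zero_mul, add_sub_add_comm, Finset.sum_add_distrib,
      Finset.sum_sub_distrib, Finset.sum_ite_eq, Finset.mem_univ, if_true, mul_sub, mul_assoc]
    abel

variable (q) in
/-- The map evaluating the second tensor factor in `C`. -/
def realizeMap : Nil q ⊗[ℂ] Nil q →ₐ[ℂ] Nil q ⊗[ℂ] C :=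
  Algebra.TensorProduct.map (AlgHom.id ℂ (Nil q)) (Nil.lift x hx)

theorem coeff_realize (n : ℕ) :
    PowerSeries.coeff n (realize x hx R) = realizeMap q hx (PowerSeries.coeff n R) := rfl

theorem commutator_realizeMap {r : ℂ} {I : C} {A B : Fin 3 → C}
    (hI : ∀ i, I * x i - x i * I = r • (A i - B i))
    (hA : ∀ i j, A i * x j = ((q : ℂ) ^ cartan i j) • (x j * A i))
    (hB : ∀ i j, B i * x j = ((q : ℂ) ^ (-cartan i j)) • (x j * B i)) (z : Nil q ⊗[ℂ] Nil q) :
    (1 ⊗ₜ I) * realizeMap q hx z - realizeMap q hx z * (1 ⊗ₜ I) =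
      ∑ i, (realizeMap q hx (r • LinearMap.lTensor (Nil q)
            (Nil.skewDer q q⁻¹ (qTwo_inv q) i) z) * (1 ⊗ₜ A i)
        - realizeMap q hx (r • LinearMap.lTensor (Nil q) (Nil.skewDer q q rfl i) z)
            * (1 ⊗ₜ B i)) := by
  induction z with
  | zero => simp
  | add z w hz hw =>
    simp only [map_add, mul_add, add_mul, smul_add, add_sub_add_comm, hz, hw,
      Finset.sum_add_distrib]
  | tmul u v =>
    simp only [realizeMap, Algebra.TensorProduct.map_tmul, LinearMap.lTensor_tmul, map_smul,
      smul_mul_assoc, Algebra.TensorProduct.tmul_mul_tmul, one_mul, mul_one,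
      AlgHom.id_apply, ← smul_sub, ← TensorProduct.tmul_sub, ← Finset.smul_sum,
      ← TensorProduct.tmul_sum]
    rw [commutator_lift hx hI hA hB, TensorProduct.tmul_smul]

/-- Applied with a = A_i, this absorbs the scaling κ_i⁻¹ left by the R-matrix relation and puts A_i
to the left of the component. -/
theorem realizeMap_mulLeft_scale {c : Fin 3 → ℂ} {a : C} (h : ∀ j, a * x j = c j • (x j * a))
    (u : Nil q) (z : Nil q ⊗[ℂ] Nil q) :
    realizeMap q hx (TensorProduct.map (LinearMap.mulLeft ℂ u) (Nil.scale q c).toLinearMap z)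
      * (1 ⊗ₜ a) = (u ⊗ₜ a) * realizeMap q hx z := by
  induction z with
  | zero => simp
  | add z w hz hw => simp only [map_add, mul_add, add_mul, hz, hw]
  | tmul v w =>
    simp [realizeMap, mul_lift_of_scale hx h]

end Realization

end AffineSl3

end

/-! ### Comparison of components -/

open AffineSl3 in
theorem proposition1 (q : ℂˣ) (hq : (q : ℂ) ^ 2 ≠ 1)
    (R : PowerSeries (AffineSl3.Nil q ⊗[ℂ] AffineSl3.Nil q))
    (hR : AffineSl3.IsReducedRMatrix q R)
    {C : Type*} [Ring C] [Algebra ℂ C] (x : Fin 3 → C) (hx : AffineSl3.Serre q x)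
    (I : C) (A B : Fin 3 → C)
    (hI : ∀ i, I * x i - x i * I = ((q : ℂ) - (q : ℂ)⁻¹)⁻¹ • (A i - B i))
    (hA : ∀ i j, A i * x j = ((q : ℂ) ^ AffineSl3.cartan i j) • (x j * A i))
    (hB : ∀ i j, B i * x j = ((q : ℂ) ^ (-AffineSl3.cartan i j)) • (x j * B i)) :
    AffineSl3.oneTensor q I * AffineSl3.realize x hx R
        - AffineSl3.realize x hx R * AffineSl3.oneTensor q I =
      AffineSl3.sumTensor q A * AffineSl3.realize x hx R
        - AffineSl3.realize x hx R * AffineSl3.sumTensor q B := by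
  -- Splitting off the variable makes the shift of degree by one explicit.
  have e : ∀ c : Fin 3 → C, sumTensor q c =
      PowerSeries.C (∑ i, Nil.gen q i ⊗ₜ[ℂ] c i) * PowerSeries.X := fun c => by
    ext n
    cases n <;> simp [sumTensor, PowerSeries.coeff_monomial, PowerSeries.coeff_C]
  rw [oneTensor, PowerSeries.monomial_zero_eq_C_apply, e, e]
  ext n
  rw [map_sub, map_sub, PowerSeries.coeff_C_mul, PowerSeries.coeff_mul_C, coeff_realize, mul_assoc,
    PowerSeries.coeff_C_mul, ← mul_assoc]
  cases n with
  -- In degree zero `R` is 1, which commutes with 1 ⊗ I, and the right side starts in degree one.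
  | zero => simp [hR.constant]
  | succ n =>
    rw [PowerSeries.coeff_succ_X_mul, PowerSeries.coeff_succ_mul_X, PowerSeries.coeff_mul_C,
      coeff_realize, commutator_realizeMap hx hI hA hB, Finset.sum_sub_distrib, Finset.sum_mul,
      Finset.mul_sum]
    -- The A-terms use the relation for P'_i, the B-terms the one for P_i.
    congr 1
    · refine Finset.sum_congr rfl fun i _ => ?_
      rw [(hR.map_skewDer i n).2]
      exact realizeMap_mulLeft_scale hx (fun j => by rw [Nil.weight_inv]; exact hA i j) _ _
    · refine Finset.sum_congr rfl fun i _ => ?_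
      rw [(hR.map_skewDer i n).1, map_mul, mul_assoc]
      simp [realizeMap]
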